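/- Let $c>0$ and $0<S<\infty$, let $u\mapsto T_u$, $u\ge 0$, be a positive, bounded, measurable (deterministic) function, and let $X=\{X(t),t\ge 0\}$ be a real-valued Lévy process (started at $0$, with stationary independent increments, stochastically continuous, with a.s. càdlàg paths). Put $R_u(t)=u+ct-X(t)$ and define the Parisian ruin probability $$\mathcal P_S(u,T_u)=\mathbb P\Big(\inf_{t\in[0,S]}\ \sup_{s\in[t,t+T_u]}R_u(s)<0\Big).$$ (i) Suppose that $X(S)$ has a long-tailed distribution, that is, $\mathbb P(X(S)>u)>0$ for all $u$ and there is a function $h$ with $\lim_{u\to\infty}u/h(u)=\lim_{u\to\infty}h(u)=\infty$ such that $\mathbb P(X(S)>u+h(u))=\mathbb P(X(S)>u)(1+o(1))$ as $u\to\infty$. Then $$\mathcal P_S(u,T_u)=\mathbb P(X(S)>u)\,(1+o(1)),\qquad u\to\infty.$$ (ii) In particular, suppose that $X$ is an $\alpha$-stable Lévy process with $\alpha\in(1,2)$ and skewness $\beta\in(-1,1]$, that is, for every $t>0$ the variable $X(t)$ has the stable law $\mathcal S_\alpha(t^{1/\alpha},\beta,0)$, with characteristic function $$\mathbb E\,e^{i\theta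 X(t)}=\exp\big(-t|\theta|^\alpha\,(1-i\beta\,\mathrm{sign}(\theta)\tan(\pi\alpha/2))\big),\qquad\theta\in\mathbb R .$$ Then $$\mathcal P_S(u,T_u)=\frac{1-\alpha}{\Gamma(2-\alpha)\cos(\pi\alpha/2)}\cdot\frac{1+\beta}{2}\,S\,u^{-\alpha}\,(1+o(1)),\qquad u\to\infty.$$ -/

import Mathlib

open MeasureTheory ProbabilityTheory Filter Topology Asymptotics
open scoped NNReal

/-- A real-valued function of time `t ≥ 0` is càdlàg: right-continuous with finite left limits. -/
def IsCadlag (f : ℝ≥0 → ℝ) : Prop :=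
  ∀ t : ℝ≥0, ContinuousWithinAt f (Set.Ici t) t ∧ ∃ l : ℝ, Tendsto f (𝓝[<] t) (𝓝 l)

/-- `X` is a (real-valued) Lévy process on the probability space `(Ω, P)`. -/
structure IsLevyProcess {Ω : Type*} [MeasurableSpace Ω] (P : Measure Ω) (X : ℝ≥0 → Ω → ℝ) :
    Prop where
  measurable : ∀ t, Measurable (X t)
  start_zero : ∀ᵐ ω ∂P, X 0 ω = 0
  indep_increments : HasIndepIncrements X P
  stationary_increments :
    ∀ s t : ℝ≥0, IdentDistrib (fun ω => X (s + t) ω - X s ω) (X t) P P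
  stochastically_continuous : ∀ t : ℝ≥0, TendstoInMeasure P X (𝓝 t) (X t)
  cadlag : ∀ᵐ ω ∂P, IsCadlag (fun t => X t ω)

/-- A distribution `ν` on `ℝ` is long-tailed: its right tail is positive everywhere, and it is
insensitive to a shift by some `h(u)` that tends to infinity more slowly than `u`. -/
def IsLongTailed (ν : Measure ℝ) : Prop :=
  (∀ u : ℝ, 0 < ν.real (Set.Ioi u)) ∧
  ∃ h : ℝ → ℝ, Tendsto (fun u => u / h u) atTop atTop ∧ Tendsto h atTop atTop ∧
    (fun u => ν.real (Set.Ioi (u + h u))) ~[atTop] (fun u => ν.real (Set.Ioi u))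

/-- The surplus process `R_u(t) = u + c t - X(t)`. -/
def surplus {Ω : Type*} (X : ℝ≥0 → Ω → ℝ) (c u : ℝ) (t : ℝ≥0) (ω : Ω) : ℝ :=
  u + c * t - X t ω

/-- The Parisian ruin probability
`P (inf_{t ∈ [0,S]} sup_{s ∈ [t,t+T]} R_u(s) < 0)`; infimum and supremum are taken in `EReal`, so
that they are the true ones for every path. -/
noncomputable def parisianRuinProb {Ω : Type*} [MeasurableSpace Ω] (P : Measure Ω)
    (X : ℝ≥0 → Ω → ℝ) (c : ℝ) (S : ℝ≥0) (u : ℝ) (T : ℝ≥0) : ℝ :=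
  P.real {ω | (⨅ t ∈ Set.Icc (0 : ℝ≥0) S, ⨆ s ∈ Set.Icc t (t + T),
    ((surplus X c u s ω : ℝ) : EReal)) < 0}

/-- The characteristic function of the stable law with index of stability `α`, scale `σ`,
skewness `β` and shift `d`. -/
noncomputable def stableCharFun (α σ β d : ℝ) (θ : ℝ) : ℂ :=
  if α = 1 then
    Complex.exp (-((σ * |θ| : ℝ) : ℂ) *
        (1 + Complex.I * ((β * (2 / Real.pi) * Real.sign θ * Real.log |θ| : ℝ) : ℂ))
      + Complex.I * ((d * θ : ℝ) : ℂ))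
  else
    Complex.exp (-((σ ^ α * |θ| ^ α : ℝ) : ℂ) *
        (1 - Complex.I * ((β * Real.sign θ * Real.tan (Real.pi * α / 2) : ℝ) : ℂ))
      + Complex.I * ((d * θ : ℝ) : ℂ))

/-- `ν` is the stable law `S_α(σ, β, d)`, i.e. it has the corresponding characteristic function. -/
def IsStableLaw (ν : Measure ℝ) (α σ β d : ℝ) : Prop :=
  ∀ θ : ℝ, charFun ν θ = stableCharFun α σ β d θ

/-- `X` is an `α`-stable Lévy process with skewness `β`: a Lévy process with
`X(t) ∼ S_α(t^{1/α}, β, 0)` for every `t > 0`. -/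
def IsStableLevyProcess {Ω : Type*} [MeasurableSpace Ω] (P : Measure Ω) (X : ℝ≥0 → Ω → ℝ)
    (α β : ℝ) : Prop :=
  IsLevyProcess P X ∧
    ∀ t : ℝ≥0, 0 < t → IsStableLaw (P.map (X t)) α ((t : ℝ) ^ (1 / α)) β 0

/-! Part (i) is a two-sided sandwich. Parisian ruin forces `R_u(t) < 0`, hence `X(t) > u`, at some
`t ≤ S`. Ottaviani's inequality gives, for each `p < 1`, a constant `a` with `p * P(sup_{t ≤ S} X(t)
> v + a) ≤ P(X(S) > v)` for all `v`. Conversely, let `M` bound the Parisian delays. If `X(S)`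
exceeds `u` by a suitable constant and the path then falls by at most `b` on `[S, S + M]`, the
surplus stays negative throughout `[S, S + T_u]`; the fall is independent of `X(S)`, and `b` can be
chosen to keep it within bounds with probability at least `p`. Thus, up to a factor `p`, the ruin
probability lies between tails of `X(S)` at levels shifted by constants. A long tail does not feel
such shifts, and `p` is arbitrarily close to `1`.

Part (ii) needs the tail of a stable law `Q`, read off its characteristic function `exp(-ψ)`. The
finite measures `y^α (1 - cos x) Q(y dx)` have as Fourier transform a second difference of `y^α
exp(-ψ(θ/y))`, which by homogeneity of `ψ` tends to that of `-ψ`. The limit is the transform of the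
Lévy measure tilted by `1 - cos x`, because `∫ (e^{-lx} - 1 + lx) x^{-1-α} dx` is a multiple of
`l^α`. Lévy's continuity theorem then gives the mass of `(y, 2y]` to leading order, and dyadic
summation gives the tail, which is regularly varying and so long-tailed. -/

/-! ### Càdlàg paths -/

theorem IsCadlag.bounded_on_Iic {f : ℝ≥0 → ℝ} (hf : IsCadlag f) (M : ℝ≥0) :
    ∃ B : ℝ, ∀ t ≤ M, |f t| ≤ B := by
  have key : ∃ B : ℝ, ∀ t ∈ Set.Icc 0 M, |f t| ≤ B := by
    -- Compactness reduces the claim to local bounds: right-continuity supplies one on the right of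
    -- each point, the left limit one on the left.
    refine isCompact_Icc.induction_on (p := fun s => ∃ B : ℝ, ∀ t ∈ s, |f t| ≤ B) ⟨0, by simp⟩
      (fun s t hst ⟨B, hB⟩ => ⟨B, fun x hx => hB x (hst hx)⟩) ?_ ?_
    · rintro s t ⟨B, hB⟩ ⟨B', hB'⟩
      refine ⟨max B B', fun x hx => ?_⟩
      rcases hx with hx | hx
      · exact (hB x hx).trans (le_max_left _ _)
      · exact (hB' x hx).trans (le_max_right _ _)
    · intro t _
      obtain ⟨hr, l, hl⟩ := hf t
      have h1 : ∀ᶠ s in 𝓝[≥] t, |f s| ≤ |f t| + 1 :=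
        (hr.tendsto.abs.eventually_lt_const (lt_add_one _)).mono fun _ h => h.le
      have h2 : ∀ᶠ s in 𝓝[<] t, |f s| ≤ |l| + 1 :=
        (hl.abs.eventually_lt_const (lt_add_one _)).mono fun _ h => h.le
      have h3 : ∀ᶠ s in 𝓝 t, |f s| ≤ max (|f t| + 1) (|l| + 1) := by
        rw [← nhdsLT_sup_nhdsGE t, eventually_sup]
        exact ⟨h2.mono fun _ h => h.trans (le_max_right _ _),
          h1.mono fun _ h => h.trans (le_max_left _ _)⟩
      exact ⟨_, mem_nhdsWithin_of_mem_nhds h3, _, fun s hs => hs⟩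
  obtain ⟨B, hB⟩ := key
  exact ⟨B, fun t ht => hB t ⟨zero_le, ht⟩⟩

/-- A right-continuous path that visits an open set in `[r, r + L]` visits it at a dyadic time. -/
theorem IsCadlag.exists_dyadic {f : ℝ≥0 → ℝ} (hf : IsCadlag f) {U : Set ℝ} (hU : IsOpen U)
    {r L t : ℝ≥0} (hL : 0 < L) (hrt : r ≤ t) (htL : t ≤ r + L) (ht : f t ∈ U) :
    ∃ n k : ℕ, k ≤ 2 ^ n ∧ f (r + k * L / 2 ^ n) ∈ U := by
  have h1 : ∀ᶠ s in 𝓝[≥] t, f s ∈ U := (hf t).1.tendsto (hU.mem_nhds ht)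
  obtain ⟨d, hd, hdU⟩ := (mem_nhdsGE_iff_exists_Ico_subset' (lt_add_one t)).1 h1
  have hd' : t < d := hd
  obtain ⟨n, hn⟩ := pow_unbounded_of_one_lt (L / (d - t)) one_lt_two
  have hdt : 0 < d - t := tsub_pos_of_lt hd'
  have hn' : L / 2 ^ n < d - t := by
    rw [div_lt_iff₀ hdt] at hn
    rw [div_lt_iff₀ (by positivity)]; rwa [mul_comm]
  -- The first grid point at or after `t`; since the mesh is below `d - t`, it lies in `[t, d)`.
  set k := ⌈(t - r) * 2 ^ n / L⌉₊ with hk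
  have hk1 : (t - r) * 2 ^ n / L ≤ k := Nat.le_ceil _
  have hk2 : (k : ℝ≥0) < (t - r) * 2 ^ n / L + 1 := Nat.ceil_lt_add_one zero_le
  refine ⟨n, k, ?_, hdU ⟨?_, ?_⟩⟩
  · apply Nat.ceil_le.2
    rw [div_le_iff₀ hL]
    push_cast
    rw [mul_comm]
    gcongr
    exact tsub_le_iff_left.2 htL
  · have : t - r ≤ k * L / 2 ^ n := by
      rw [le_div_iff₀ (by positivity)]
      rwa [div_le_iff₀ hL] at hk1
    exact tsub_le_iff_left.1 this
  · have h2 : k * L / 2 ^ n < (t - r) + L / 2 ^ n := by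
      calc k * L / 2 ^ n < ((t - r) * 2 ^ n / L + 1) * L / 2 ^ n := by gcongr
        _ = (t - r) + L / 2 ^ n := by field_simp
    calc r + k * L / 2 ^ n < r + ((t - r) + L / 2 ^ n) := by gcongr
      _ < r + ((t - r) + (d - t)) := by gcongr
      _ = d := by rw [← add_assoc, add_tsub_cancel_of_le hrt, add_tsub_cancel_of_le hd'.le]

/-! ### Partial sums of independent variables -/

section PartialSums

variable {Ω : Type*} [MeasurableSpace Ω] {P : Measure Ω}

/-- Ottaviani's maximal inequality for sums of independent random variables. -/
theorem ottaviani_inequality [IsProbabilityMeasure P] {Y : ℕ → Ω → ℝ}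
    (hY : iIndepFun Y P) (hm : ∀ i, Measurable (Y i)) (N : ℕ) (v a p : ℝ)
    (h : ∀ k ≤ N, p ≤ P.real {ω | -a ≤ ∑ i ∈ Finset.Ico k N, Y i ω}) :
    p * P.real {ω | ∃ k ≤ N, v + a < ∑ i ∈ Finset.range k, Y i ω} ≤
      P.real {ω | v < ∑ i ∈ Finset.range N, Y i ω} := by
  -- `A k` says that level `v + a` is first passed at `k`, so it depends on the first `k` variables
  -- only, while `B k` depends on the others. On `A k ∩ B k` the final sum is still above `v`.
  set A : ℕ → Set Ω := fun k => {ω | v + a < ∑ i ∈ Finset.range k, Y i ω ∧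
    ∀ j < k, ∑ i ∈ Finset.range j, Y i ω ≤ v + a} with hA
  set B : ℕ → Set Ω := fun k => {ω | -a ≤ ∑ i ∈ Finset.Ico k N, Y i ω} with hB
  have hAm : ∀ k, MeasurableSet (A k) := fun k => by
    have : A k = {ω | v + a < ∑ i ∈ Finset.range k, Y i ω} ∩
      ⋂ j, ⋂ (_ : j < k), {ω | ∑ i ∈ Finset.range j, Y i ω ≤ v + a} := by ext; simp [hA]
    rw [this]
    exact (measurableSet_lt (by fun_prop) (by fun_prop)).inter <|
      MeasurableSet.iInter fun j => MeasurableSet.iInter fun _ =>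
        measurableSet_le (by fun_prop) (by fun_prop)
  have hBm : ∀ k, MeasurableSet (B k) := fun k =>
    measurableSet_le (by fun_prop) (by fun_prop)
  have hdisj : Pairwise (Function.onFun Disjoint A) := by
    intro i j hij
    rw [Function.onFun, Set.disjoint_left]
    rintro ω ⟨h1, h2⟩ ⟨h3, h4⟩
    rcases lt_or_gt_of_ne hij with h | h
    · exact absurd (h4 i h) (not_le.2 h1)
    · exact absurd (h2 j h) (not_le.2 h3)
  have hind : ∀ k, P.real (A k ∩ B k) = P.real (A k) * P.real (B k) := fun k => by
    have hi := hY.indepFun_finset (Finset.range k) (Finset.Ico k N) (by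
      rw [Finset.disjoint_left]; intro i; simp; omega) hm
    -- Both events must be preimages under the vector of one block; shorter partial sums become sums
    -- with cut-off over the index type of that block.
    have := hi.measure_inter_preimage_eq_mul
      {y | v + a < ∑ i, y i ∧ ∀ j < k, ∑ i, (if i.1 < j then y i else 0) ≤ v + a}
      {y | -a ≤ ∑ i, y i} ?_ (measurableSet_le (by fun_prop) (by fun_prop))
    · have e1 : (fun ω (i : Finset.range k) => Y i ω) ⁻¹' {y | v + a < ∑ i, y i ∧
          ∀ j < k, ∑ i, (if i.1 < j then y i else 0) ≤ v + a} = A k := by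
        ext ω
        simp only [Set.mem_preimage, Set.mem_ofPred_eq, hA]
        rw [Finset.sum_coe_sort (Finset.range k) (fun i => Y i ω)]
        refine and_congr_right fun _ => forall_congr' fun j => forall_congr' fun hj => ?_
        rw [Finset.sum_coe_sort (Finset.range k) (fun i => if i < j then Y i ω else 0),
          ← Finset.sum_filter]
        have : (Finset.range k).filter (· < j) = Finset.range j := by ext; simp; omega
        rw [this]
      have e2 : (fun ω (i : Finset.Ico k N) => Y i ω) ⁻¹' {y | -a ≤ ∑ i, y i} = B k := by
        ext ω
        simp only [Set.mem_preimage, Set.mem_ofPred_eq, hB]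
        rw [Finset.sum_coe_sort (Finset.Ico k N) (fun i => Y i ω)]
      rw [e1, e2] at this
      simp only [measureReal_def, this, ENNReal.toReal_mul]
    · have : {y : Finset.range k → ℝ | v + a < ∑ i, y i ∧
          ∀ j < k, ∑ i, (if i.1 < j then y i else 0) ≤ v + a} = {y | v + a < ∑ i, y i} ∩
          ⋂ j, ⋂ (_ : j < k), {y | ∑ i, (if i.1 < j then y i else 0) ≤ v + a} := by ext; simp
      rw [this]
      refine (measurableSet_lt (by fun_prop) (by fun_prop)).inter <|
        MeasurableSet.iInter fun j => MeasurableSet.iInter fun _ =>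
        measurableSet_le (Finset.measurable_sum _ fun i _ => ?_) (by fun_prop)
      split_ifs <;> fun_prop
  have hsub : {ω | ∃ k ≤ N, v + a < ∑ i ∈ Finset.range k, Y i ω} ⊆
      ⋃ k ∈ Finset.range (N + 1), A k := by
    rintro ω ⟨k, hk, hv⟩
    have hex : ∃ k, v + a < ∑ i ∈ Finset.range k, Y i ω := ⟨k, hv⟩
    classical
    simp only [Set.mem_iUnion, Finset.mem_range]
    refine ⟨Nat.find hex, ?_, Nat.find_spec hex, fun j hj => not_lt.1 (Nat.find_min hex hj)⟩
    have := Nat.find_min' hex hv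
    omega
  have hp : p ≤ 1 := (h 0 zero_le).trans measureReal_le_one
  rcases le_total p 0 with hp0 | hp0
  · exact (mul_nonpos_of_nonpos_of_nonneg hp0 measureReal_nonneg).trans measureReal_nonneg
  calc p * P.real {ω | ∃ k ≤ N, v + a < ∑ i ∈ Finset.range k, Y i ω}
      ≤ p * P.real (⋃ k ∈ Finset.range (N + 1), A k) := by
        gcongr
        exact measure_ne_top _ _
    _ = ∑ k ∈ Finset.range (N + 1), p * P.real (A k) := by
        rw [measureReal_biUnion_finset (fun i _ j _ hij => hdisj hij) (fun i _ => hAm i),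
          Finset.mul_sum]
    _ ≤ ∑ k ∈ Finset.range (N + 1), P.real (A k ∩ B k) := by
        refine Finset.sum_le_sum fun k hk => ?_
        rw [hind, mul_comm]
        exact mul_le_mul_of_nonneg_left (h k (by simpa [Nat.lt_succ_iff] using hk)) measureReal_nonneg
    _ = P.real (⋃ k ∈ Finset.range (N + 1), A k ∩ B k) := by
        rw [measureReal_biUnion_finset (fun i _ j _ hij =>
          (hdisj hij).mono Set.inter_subset_left Set.inter_subset_left)
          (fun i _ => (hAm i).inter (hBm i))]
    _ ≤ P.real {ω | v < ∑ i ∈ Finset.range N, Y i ω} := by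
        refine measureReal_mono ?_
        intro ω hω
        simp only [Set.mem_iUnion, Finset.mem_range] at hω
        obtain ⟨k, hk, hA', hB'⟩ := hω
        have h1 := Finset.sum_range_add_sum_Ico (fun i => Y i ω) (Nat.lt_succ_iff.1 hk)
        have h2 : v + a < ∑ i ∈ Finset.range k, Y i ω := hA'.1
        have h3 : -a ≤ ∑ i ∈ Finset.Ico k N, Y i ω := hB'
        change v < _
        linarith

/-- The blocks `{0}` and `[1, N]` are disjoint. Later `Y 0` is the increment over `[0, S]` and the
other variables are increments after `S`. -/
theorem measureReal_first_inter_partialSums {Y : ℕ → Ω → ℝ} (hY : iIndepFun Y P)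
    (hm : ∀ i, Measurable (Y i)) (N : ℕ) (w b : ℝ) :
    P.real ({ω | w < Y 0 ω} ∩ {ω | ∀ k ≤ N, -b ≤ ∑ i ∈ Finset.range k, Y (i + 1) ω}) =
      P.real {ω | w < Y 0 ω} *
        P.real {ω | ∀ k ≤ N, -b ≤ ∑ i ∈ Finset.range k, Y (i + 1) ω} := by
  have hi := hY.indepFun_finset {0} (Finset.Ico 1 (N + 1)) (by simp) hm
  have := hi.measure_inter_preimage_eq_mul
    {y | w < ∑ i, y i}
    {y | ∀ k ≤ N, -b ≤ ∑ i, (if i.1 < k + 1 then y i else 0)}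
    (measurableSet_lt (by fun_prop) (by fun_prop)) ?_
  · have e1 : (fun ω (i : ({0} : Finset ℕ)) => Y i ω) ⁻¹' {y | w < ∑ i, y i} =
        {ω | w < Y 0 ω} := by
      ext ω
      simp only [Set.mem_preimage, Set.mem_ofPred_eq]
      rw [Finset.sum_coe_sort {0} (fun i => Y i ω), Finset.sum_singleton]
    have e2 : (fun ω (i : Finset.Ico 1 (N + 1)) => Y i ω) ⁻¹'
        {y | ∀ k ≤ N, -b ≤ ∑ i, (if i.1 < k + 1 then y i else 0)} =
        {ω | ∀ k ≤ N, -b ≤ ∑ i ∈ Finset.range k, Y (i + 1) ω} := by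
      ext ω
      simp only [Set.mem_preimage, Set.mem_ofPred_eq]
      refine forall_congr' fun k => forall_congr' fun hk => ?_
      rw [Finset.sum_coe_sort (Finset.Ico 1 (N + 1)) (fun i => if i < k + 1 then Y i ω else 0),
          ← Finset.sum_filter]
      have : (Finset.Ico 1 (N + 1)).filter (· < k + 1) = Finset.Ico 1 (k + 1) := by
        ext; simp; omega
      rw [this, Finset.sum_Ico_eq_sum_range]
      simp [add_comm]
    rw [e1, e2] at this
    simp only [measureReal_def, this, ENNReal.toReal_mul]
  · have : {y : Finset.Ico 1 (N + 1) → ℝ | ∀ k ≤ N, -b ≤ ∑ i, (if i.1 < k + 1 then y i else 0)} =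
      ⋂ k, ⋂ (_ : k ≤ N), {y | -b ≤ ∑ i, (if i.1 < k + 1 then y i else 0)} := by ext; simp
    rw [this]
    refine MeasurableSet.iInter fun j => MeasurableSet.iInter fun _ =>
      measurableSet_le (by fun_prop) (Finset.measurable_sum _ fun i _ => ?_)
    split_ifs <;> fun_prop

end PartialSums

/-- Dyadic grids are nested, which makes events defined on them monotone in the level. -/
theorem mul_div_two_pow_eq_of_le (k : ℕ) (L : ℝ≥0) {m n : ℕ} (h : m ≤ n) :
    ((k * 2 ^ (n - m) : ℕ) : ℝ≥0) * L / 2 ^ n = k * L / 2 ^ m := by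
  obtain ⟨d, rfl⟩ := Nat.exists_eq_add_of_le h
  have : (2 : ℝ≥0) ^ m ≠ 0 := by positivity
  have : (2 : ℝ≥0) ^ d ≠ 0 := by positivity
  simp only [Nat.add_sub_cancel_left]
  push_cast
  rw [pow_add]
  field_simp

theorem mul_two_pow_sub_le {k m n : ℕ} (hk : k ≤ 2 ^ m) (h : m ≤ n) :
    k * 2 ^ (n - m) ≤ 2 ^ n := by
  calc k * 2 ^ (n - m) ≤ 2 ^ m * 2 ^ (n - m) := by gcongr
    _ = 2 ^ n := by rw [← pow_add, Nat.add_sub_cancel' h]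

/-! ### Maximal inequality and independence after time `S` for Lévy processes -/

section Levy

variable {Ω : Type*} [MeasurableSpace Ω] {P : Measure Ω} [IsProbabilityMeasure P]
  {X : ℝ≥0 → Ω → ℝ}

/-- Almost every path is bounded on `[0, M]`, so the events with integer bounds increase to an
almost sure one. Continuity from below along increasing sets requires no measurability of these
events. -/
theorem IsLevyProcess.exists_le_measureReal_bounded (hX : IsLevyProcess P X) (M : ℝ≥0) {p : ℝ}
    (hp : p < 1) : ∃ B : ℝ, p ≤ P.real {ω | ∀ t ≤ M, |X t ω| ≤ B} := by
  set E : ℕ → Set Ω := fun n => {ω | ∀ t ≤ M, |X t ω| ≤ n} with hE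
  have hmono : Monotone E := fun m n hmn ω hω t ht =>
    (hω t ht).trans (by exact_mod_cast hmn)
  have huniv : P (⋃ n, E n) = 1 := by
    rw [← measure_univ (μ := P)]
    refine measure_congr ?_
    filter_upwards [hX.cadlag] with ω hω
    obtain ⟨B, hB⟩ := hω.bounded_on_Iic M
    obtain ⟨n, hn⟩ := exists_nat_ge B
    refine propext ⟨fun _ => trivial, fun _ => ?_⟩
    exact Set.mem_iUnion.2 ⟨n, fun t ht => (hB t ht).trans hn⟩
  have hlim := tendsto_measure_iUnion_atTop (μ := P) hmono
  rw [huniv] at hlim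
  have hlim' : Tendsto (fun n => P.real (E n)) atTop (𝓝 1) := by
    simpa [measureReal_def, Function.comp_def] using
      (ENNReal.tendsto_toReal ENNReal.one_ne_top).comp hlim
  obtain ⟨n, hn⟩ := (hlim'.eventually_const_lt hp).exists
  exact ⟨n, hn.le⟩

/-- Ottaviani's inequality on dyadic grids of `[0, S]`, followed by refinement. If `|X| ≤ B` on `[0,
S]`, then `X(S) - X(t) ≥ -2B`, whence `a = 2B`; the point is that `a` does not depend on `v`. -/
theorem IsLevyProcess.measureReal_exists_gt_le (hX : IsLevyProcess P X) {S : ℝ≥0} (hS : 0 < S)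
    {p : ℝ} (hp0 : 0 ≤ p) (hp : p < 1) :
    ∃ a : ℝ, ∀ v : ℝ, p * P.real {ω | ∃ t ≤ S, v + a < X t ω} ≤ P.real {ω | v < X S ω} := by
  obtain ⟨B, hB⟩ := hX.exists_le_measureReal_bounded S hp
  refine ⟨2 * B, fun v => ?_⟩
  set G : ℕ → Set Ω := fun n => {ω | ∃ k : ℕ, k ≤ 2 ^ n ∧ v + 2 * B < X (k * S / 2 ^ n) ω} with hG
  have hGmono : Monotone G := by
    rintro m n hmn ω ⟨k, hk, h⟩
    exact ⟨k * 2 ^ (n - m), mul_two_pow_sub_le hk hmn, by rwa [mul_div_two_pow_eq_of_le k S hmn]⟩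
  have hle : P.real {ω | ∃ t ≤ S, v + 2 * B < X t ω} ≤ P.real (⋃ n, G n) := by
    refine ENNReal.toReal_mono (measure_ne_top _ _) (measure_mono_ae ?_)
    filter_upwards [hX.cadlag] with ω hω
    rintro ⟨t, ht, h⟩
    obtain ⟨n, k, hk, h'⟩ := hω.exists_dyadic (isOpen_Ioi (a := v + 2 * B)) (r := 0) hS zero_le
      (by simpa using ht) h
    exact Set.mem_iUnion.2 ⟨n, k, hk, by simpa using h'⟩
  have hlim : Tendsto (fun n => P.real (G n)) atTop (𝓝 (P.real (⋃ n, G n))) :=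
    (ENNReal.tendsto_toReal (measure_ne_top _ _)).comp (tendsto_measure_iUnion_atTop hGmono)
  refine (mul_le_mul_of_nonneg_left hle hp0).trans ?_
  refine le_of_tendsto (hlim.const_mul p) (.of_forall fun n => ?_)
  have hN : ((2 ^ n : ℕ) : ℝ≥0) * S / 2 ^ n = S := by push_cast; field_simp
  have htmono : Monotone fun k : ℕ => (k : ℝ≥0) * S / 2 ^ n := fun i j hij => by
    have : (i : ℝ≥0) ≤ j := by exact_mod_cast hij
    dsimp only
    gcongr
  have hott := ottaviani_inequality (hX.indep_increments.nat htmono)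
    (fun i => (hX.measurable _).sub (hX.measurable _)) (2 ^ n) v (2 * B) p fun k hk => by
      refine hB.trans (measureReal_mono fun ω hω => ?_)
      change -(2 * B) ≤ _
      rw [Finset.sum_Ico_eq_sub _ hk, Finset.sum_range_sub (fun k : ℕ => X (k * S / 2 ^ n) ω),
        Finset.sum_range_sub (fun k : ℕ => X (k * S / 2 ^ n) ω), hN]
      have h1 := hω S le_rfl
      have h2 := hω (k * S / 2 ^ n) (by have := htmono hk; dsimp only at this; rwa [hN] at this)
      rw [abs_le] at h1 h2
      linarith [h1.1, h2.2]
  have hs : ∀ (ω : Ω) (k : ℕ), ∑ i ∈ Finset.range k,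
      (X ((i + 1 : ℕ) * S / 2 ^ n) ω - X (i * S / 2 ^ n) ω) = X (k * S / 2 ^ n) ω - X 0 ω := by
    intro ω k
    rw [Finset.sum_range_sub (fun k : ℕ => X (k * S / 2 ^ n) ω)]
    simp
  simp only [hs, hN] at hott
  have e1 : P.real {ω | ∃ k : ℕ, k ≤ 2 ^ n ∧ v + 2 * B < X (k * S / 2 ^ n) ω - X 0 ω} = P.real (G n) := by
    refine measureReal_congr ?_
    filter_upwards [hX.start_zero] with ω hω
    refine propext (exists_congr fun k : ℕ => and_congr_right fun _ => ?_)
    rw [hω, sub_zero]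
  have e2 : P.real {ω | v < X S ω - X 0 ω} = P.real {ω | v < X S ω} := by
    refine measureReal_congr ?_
    filter_upwards [hX.start_zero] with ω hω
    change (_ < _) = (_ < _)
    rw [hω, sub_zero]
  rwa [e1, e2] at hott

/-- Increments after `S` are independent of `X(S)`, and bounded paths fall by at most `2B`.
Factorisation holds on each dyadic grid, and the grid events decrease to the one for all times. -/
theorem IsLevyProcess.le_measureReal_inter (hX : IsLevyProcess P X) (S : ℝ≥0) {M : ℝ≥0}
    (hM : 0 < M) {p : ℝ} (hp : p < 1) :
    ∃ b : ℝ, ∀ w : ℝ, p * P.real {ω | w < X S ω} ≤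
      P.real ({ω | w < X S ω} ∩ {ω | ∀ s, S ≤ s → s ≤ S + M → -b ≤ X s ω - X S ω}) := by
  obtain ⟨B, hB⟩ := hX.exists_le_measureReal_bounded (S + M) hp
  refine ⟨2 * B, fun w => ?_⟩
  set W : Set Ω := {ω | w < X S ω} with hW
  set D : ℕ → Set Ω := fun n =>
    {ω | ∀ k : ℕ, k ≤ 2 ^ n → -(2 * B) ≤ X (S + k * M / 2 ^ n) ω - X S ω} with hD
  have hDanti : Antitone D := by
    intro m n hmn ω hω k hk
    rw [← mul_div_two_pow_eq_of_le k M hmn]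
    exact hω _ (mul_two_pow_sub_le hk hmn)
  have hWm : MeasurableSet W := measurableSet_lt measurable_const (hX.measurable S)
  have hDm : ∀ n, MeasurableSet (D n) := fun n => by
    have : D n = ⋂ k : ℕ, ⋂ (_ : k ≤ 2 ^ n),
      {ω | -(2 * B) ≤ X (S + k * M / 2 ^ n) ω - X S ω} := by ext; simp [hD]
    rw [this]
    exact MeasurableSet.iInter fun k => MeasurableSet.iInter fun _ =>
      measurableSet_le measurable_const ((hX.measurable _).sub (hX.measurable _))
  have hle : P.real (⋂ n, W ∩ D n) ≤
      P.real (W ∩ {ω | ∀ s, S ≤ s → s ≤ S + M → -(2 * B) ≤ X s ω - X S ω}) := by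
    refine ENNReal.toReal_mono (measure_ne_top _ _) (measure_mono_ae ?_)
    filter_upwards [hX.cadlag] with ω hω
    intro h
    have h' : ∀ n, ω ∈ W ∩ D n := Set.mem_iInter.1 h
    refine ⟨(h' 0).1, fun s hs1 hs2 => ?_⟩
    by_contra! hcon
    obtain ⟨n, k, hk, hlt⟩ := hω.exists_dyadic (isOpen_Iio (a := X S ω - 2 * B)) hM hs1 hs2
      (by simp only [Set.mem_Iio]; linarith)
    have := (h' n).2 k hk
    simp only [Set.mem_Iio] at hlt
    linarith
  have hlim : Tendsto (fun n => P.real (W ∩ D n)) atTop (𝓝 (P.real (⋂ n, W ∩ D n))) :=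
    (ENNReal.tendsto_toReal (measure_ne_top _ _)).comp
      (tendsto_measure_iInter_atTop (fun n => (hWm.inter (hDm n)).nullMeasurableSet)
        (fun m n h => Set.inter_subset_inter_right _ (hDanti h)) ⟨0, measure_ne_top _ _⟩)
  refine le_trans (ge_of_tendsto hlim (.of_forall fun n => ?_)) hle
  -- Time `0` is put in front of the grid of `[S, S + M]`, so that the increment with index `0` is
  -- `X(S) - X(0)`.
  set τ : ℕ → ℝ≥0 := fun k => Nat.casesOn k 0 (fun k => S + k * M / 2 ^ n) with hτ
  have hτmono : Monotone τ := by
    refine monotone_nat_of_le_succ fun k => ?_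
    cases k with
    | zero => exact zero_le
    | succ k =>
      simp only [hτ]
      gcongr
      simp
  have hfac := measureReal_first_inter_partialSums (hX.indep_increments.nat hτmono)
    (fun i => (hX.measurable _).sub (hX.measurable _)) (2 ^ n) w (2 * B)
  have hs : ∀ (ω : Ω) (k : ℕ), ∑ i ∈ Finset.range k,
      (X (τ (i + 1 + 1)) ω - X (τ (i + 1)) ω) = X (S + k * M / 2 ^ n) ω - X S ω := by
    intro ω k
    rw [Finset.sum_range_sub (fun k : ℕ => X (τ (k + 1)) ω)]
    simp [hτ]
  have h0 : {ω | w < X (τ (0 + 1)) ω - X (τ 0) ω} =ᵐ[P] W := by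
    filter_upwards [hX.start_zero] with ω hω
    change (_ < _) = (_ < _)
    simp [hτ, hω]
  simp only [hs] at hfac
  have h0' : ({ω | w < X (τ (0 + 1)) ω - X (τ 0) ω} ∩ D n : Set Ω) =ᵐ[P] (W ∩ D n : Set Ω) :=
    h0.inter .rfl
  have hfac' := hfac
  rw [measureReal_congr h0, measureReal_congr h0'] at hfac'
  change p * P.real W ≤ P.real (W ∩ D n)
  rw [hfac', mul_comm]
  refine mul_le_mul_of_nonneg_left (hB.trans (measureReal_mono fun ω hω k hk => ?_))
    measureReal_nonneg
  have h1 := hω S (by simp)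
  have h2 := hω (S + k * M / 2 ^ n) (by
    gcongr
    rw [div_le_iff₀ (by positivity), mul_comm]
    gcongr
    exact_mod_cast hk)
  rw [abs_le] at h1 h2
  linarith [h1.2, h2.1]

end Levy

/-! ### Parisian ruin with a long-tailed terminal value -/

/-- For `a ≥ 0`, eventually `a ≤ h u`, so the ratio is squeezed between the long-tail ratio and `1`.
Negative shifts follow by translating `u` and inverting. -/
theorem IsLongTailed.tendsto_shift_ratio {ν : Measure ℝ} [IsFiniteMeasure ν] (hν : IsLongTailed ν)
    (a : ℝ) :
    Tendsto (fun u => ν.real (Set.Ioi (u + a)) / ν.real (Set.Ioi u)) atTop (𝓝 1) := by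
  have key : ∀ a : ℝ, 0 ≤ a →
      Tendsto (fun u => ν.real (Set.Ioi (u + a)) / ν.real (Set.Ioi u)) atTop (𝓝 1) := by
    intro a ha
    obtain ⟨hpos, h, -, hh, heq⟩ := hν
    have hlim := (isEquivalent_iff_tendsto_one (.of_forall fun u => (hpos u).ne')).1 heq
    refine tendsto_of_tendsto_of_tendsto_of_le_of_le' hlim tendsto_const_nhds ?_ ?_
    · filter_upwards [hh.eventually_ge_atTop a] with u hu
      have := hpos u
      simp only [Pi.div_apply]
      gcongr
      exact measure_ne_top _ _
    · refine .of_forall fun u => div_le_one_of_le₀ ?_ measureReal_nonneg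
      exact measureReal_mono (Set.Ioi_subset_Ioi (by linarith))
  rcases le_total 0 a with ha | ha
  · exact key a ha
  · have h1 := ((key (-a) (by linarith)).comp
      (tendsto_atTop_add_const_right atTop a tendsto_id)).inv₀ one_ne_zero
    simpa [Function.comp_def] using h1

/-- With `p` fixed, `u → ∞` absorbs the shift and leaves only the factor `p`; then `p` is taken
close to `1`. -/
theorem isEquivalent_of_shift_bounds {G : ℝ → ℝ} (hG : ∀ u, 0 < G u)
    (hshift : ∀ a, Tendsto (fun u => G (u + a) / G u) atTop (𝓝 1)) {q : ℝ≥0 → ℝ}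
    (hle : ∀ p : ℝ, 0 < p → p < 1 → ∃ a, ∀ u : ℝ≥0, p * q u ≤ G (u + a))
    (hge : ∀ p : ℝ, 0 < p → p < 1 → ∃ b, ∀ u : ℝ≥0, p * G (u + b) ≤ q u) :
    q ~[atTop] fun u : ℝ≥0 => G u := by
  rw [isEquivalent_iff_tendsto_one (.of_forall fun u => (hG _).ne')]
  have hcoe : ∀ a, Tendsto (fun u : ℝ≥0 => G (u + a) / G u) atTop (𝓝 1) := fun a =>
    (hshift a).comp (NNReal.tendsto_coe_atTop.2 tendsto_id)
  refine tendsto_order.2 ⟨fun c hc => ?_, fun c hc => ?_⟩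
  · obtain ⟨p, hp, hp1⟩ := exists_between (max_lt hc one_pos)
    obtain ⟨hp, hp0⟩ := max_lt_iff.1 hp
    obtain ⟨b, hb⟩ := hge p hp0 hp1
    have := (hcoe b).const_mul p
    rw [mul_one] at this
    filter_upwards [this.eventually_const_lt hp] with u hu
    refine hu.trans_le ?_
    rw [← mul_div_assoc, Pi.div_apply]
    exact div_le_div_of_nonneg_right (hb u) (hG u).le
  · have hc0 : 0 < c := one_pos.trans hc
    obtain ⟨p, hp, hp1⟩ := exists_between (inv_lt_one_of_one_lt₀ hc)
    have hp0 : 0 < p := (inv_pos.2 hc0).trans hp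
    obtain ⟨a, ha⟩ := hle p hp0 hp1
    have hpc : 1 < p * c := by rwa [inv_lt_iff_one_lt_mul₀ hc0] at hp
    filter_upwards [(hcoe a).eventually_lt_const hpc] with u hu
    refine lt_of_mul_lt_mul_left (lt_of_le_of_lt ?_ hu) hp0.le
    rw [Pi.div_apply, ← mul_div_assoc]
    exact div_le_div_of_nonneg_right (ha u) (hG u).le

theorem IsLevyProcess.parisianRuinProb_isEquivalent {Ω : Type*} [MeasurableSpace Ω]
    {P : Measure Ω} [IsProbabilityMeasure P] {X : ℝ≥0 → Ω → ℝ} (hX : IsLevyProcess P X)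
    {c : ℝ} (hc : 0 < c) {S : ℝ≥0} (hS : 0 < S) {T : ℝ≥0 → ℝ≥0}
    (hT_pos : ∀ u, 0 < T u) (hT_bdd : ∃ M : ℝ≥0, ∀ u, T u ≤ M)
    (hlong : IsLongTailed (P.map (X S))) :
    (fun u : ℝ≥0 => parisianRuinProb P X c S u (T u)) ~[atTop]
        (fun u : ℝ≥0 => P.real {ω | (u : ℝ) < X S ω}) := by
  obtain ⟨M, hM⟩ := hT_bdd
  have hM0 : 0 < M := (hT_pos 0).trans_le (hM 0)
  have := Measure.isProbabilityMeasure_map (μ := P) (hX.measurable S).aemeasurable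
  have hmap : ∀ u : ℝ, (P.map (X S)).real (Set.Ioi u) = P.real {ω | u < X S ω} := fun u => by
    rw [map_measureReal_apply (hX.measurable S) measurableSet_Ioi]
    rfl
  have hpos := hlong.1
  have hshift := hlong.tendsto_shift_ratio
  simp only [hmap] at hpos hshift
  refine isEquivalent_of_shift_bounds hpos hshift (fun p hp0 hp1 => ?_) fun p hp0 hp1 => ?_
  · obtain ⟨a, ha⟩ := hX.measureReal_exists_gt_le hS hp0.le hp1
    refine ⟨-a, fun u => le_trans ?_ (ha (u + -a))⟩
    refine mul_le_mul_of_nonneg_left (measureReal_mono fun ω hω => ?_) hp0.le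
    obtain ⟨t, ht⟩ := iInf_lt_iff.1 (show (⨅ t ∈ Set.Icc (0 : ℝ≥0) S,
      ⨆ s ∈ Set.Icc t (t + T u), ((surplus X c u s ω : ℝ) : EReal)) < 0 from hω)
    obtain ⟨htS, ht⟩ := iInf_lt_iff.1 ht
    have h1 : ((surplus X c u t ω : ℝ) : EReal) < 0 :=
      (le_iSup₂ (f := fun s (_ : s ∈ Set.Icc t (t + T u)) => ((surplus X c u s ω : ℝ) : EReal))
        t ⟨le_rfl, by simp⟩).trans_lt ht
    have h2 : surplus X c u t ω < 0 := by exact_mod_cast h1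
    refine ⟨t, htS.2, ?_⟩
    rw [surplus] at h2
    have : 0 ≤ c * (t : ℝ) := by positivity
    linarith
  · obtain ⟨b, hb⟩ := hX.le_measureReal_inter S hM0 hp1
    -- The level pays for the largest drift on `[S, S + M]` and the largest fall; the extra `1`
    -- keeps the surplus at most `-1`, so that its supremum is strictly negative.
    refine ⟨c * (S + M) + b + 1, fun u => (hb _).trans (measureReal_mono fun ω hω => ?_)⟩
    obtain ⟨h1, h2⟩ := hω
    have h1' : (u : ℝ) + (c * (S + M) + b + 1) < X S ω := h1
    change (⨅ t ∈ Set.Icc (0 : ℝ≥0) S,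
      ⨆ s ∈ Set.Icc t (t + T u), ((surplus X c u s ω : ℝ) : EReal)) < 0
    refine lt_of_le_of_lt (iInf₂_le S ⟨zero_le, le_rfl⟩) ?_
    refine lt_of_le_of_lt (b := ((-1 : ℝ) : EReal)) (iSup₂_le fun s hs => ?_) ?_
    · have hsM : s ≤ S + M := hs.2.trans (by gcongr; exact hM u)
      have h3 := h2 s hs.1 hsM
      have h4 : c * (s : ℝ) ≤ c * (S + M) := by
        gcongr
        exact_mod_cast hsM
      rw [EReal.coe_le_coe_iff, surplus]
      linarith
    · exact_mod_cast (by norm_num : (-1 : ℝ) < 0)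

/-! ### The Gamma integral at a complex rate -/

section GammaIntegral

theorem integrableOn_rpow_mul_exp_neg {p r : ℝ} (hp : 0 < p) (hr : 0 < r) :
    IntegrableOn (fun x : ℝ => x ^ (p - 1) * Real.exp (-(r * x))) (Set.Ioi 0) := by
  have := integrableOn_rpow_mul_exp_neg_mul_rpow (s := p - 1) (p := 1) (b := r) (by linarith)
    one_pos hr
  simpa [neg_mul] using this

theorem integrableOn_rpow_mul_cexp_neg {p : ℝ} (hp : 0 < p) {l : ℂ} (hl : 0 < l.re) :
    IntegrableOn (fun x : ℝ => ((x ^ (p - 1) : ℝ) : ℂ) * Complex.exp (-(l * x))) (Set.Ioi 0) := by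
  refine Integrable.mono' (integrableOn_rpow_mul_exp_neg hp hl)
    (Measurable.aestronglyMeasurable (by fun_prop)) ?_
  refine (ae_restrict_iff' measurableSet_Ioi).2 (.of_forall fun x hx => ?_)
  rw [norm_mul, Complex.norm_exp, Complex.norm_real, Real.norm_eq_abs,
    abs_of_nonneg (Real.rpow_nonneg (le_of_lt hx) _)]
  simp

/-- The Gamma integral with a complex rate. -/
theorem integral_rpow_mul_cexp_neg {p : ℝ} (hp : 0 < p) {l : ℂ} (hl : 0 < l.re) :
    ∫ x : ℝ in Set.Ioi 0, ((x ^ (p - 1) : ℝ) : ℂ) * Complex.exp (-(l * x)) =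
      Real.Gamma p * l ^ (-p : ℂ) := by
  -- The integral is the complex moment generating function of this measure at `-l`, hence analytic
  -- where `Re l > 0`. The formula is known for real rates and extends by the identity theorem.
  set μ : Measure ℝ := (volume.restrict (Set.Ioi 0)).withDensity
    fun x => ENNReal.ofReal (x ^ (p - 1)) with hμ
  have hmeas : Measurable fun x : ℝ => ENNReal.ofReal (x ^ (p - 1)) := by fun_prop
  have htop : ∀ᵐ x : ℝ ∂volume.restrict (Set.Ioi 0), ENNReal.ofReal (x ^ (p - 1)) < ⊤ :=
    .of_forall fun _ => ENNReal.ofReal_lt_top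
  have hreal : ∀ x ∈ Set.Ioi (0 : ℝ), (ENNReal.ofReal (x ^ (p - 1))).toReal = x ^ (p - 1) :=
    fun x hx => ENNReal.toReal_ofReal (Real.rpow_nonneg (le_of_lt hx) _)
  have hset : Set.Iio (0 : ℝ) ⊆ integrableExpSet id μ := by
    intro t ht
    change Integrable (fun x : ℝ => Real.exp (t * x)) μ
    rw [integrable_withDensity_iff_integrable_smul' hmeas htop]
    refine (integrableOn_rpow_mul_exp_neg hp (neg_pos.2 ht)).congr ?_
    refine (ae_restrict_iff' measurableSet_Ioi).2 (.of_forall fun x hx => ?_)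
    simp only
    rw [hreal x hx, smul_eq_mul, neg_mul, neg_neg]
  have hmgf : ∀ z : ℂ, complexMGF id μ z =
      ∫ x : ℝ in Set.Ioi 0, ((x ^ (p - 1) : ℝ) : ℂ) * Complex.exp (z * x) := by
    intro z
    rw [complexMGF, integral_withDensity_eq_integral_toReal_smul hmeas htop]
    refine setIntegral_congr_fun measurableSet_Ioi fun x hx => ?_
    rw [hreal x hx, Complex.real_smul]
    simp
  have hanal : AnalyticOnNhd ℂ (complexMGF id μ) {z | z.re < 0} :=
    analyticOnNhd_complexMGF.mono fun z hz =>
      mem_interior.2 ⟨_, hset, isOpen_Iio, hz⟩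
  have hopen : IsOpen {z : ℂ | z.re < 0} := isOpen_lt Complex.continuous_re continuous_const
  have hanal' : AnalyticOnNhd ℂ (fun z : ℂ => (Real.Gamma p : ℂ) * (-z) ^ (-p : ℂ))
      {z | z.re < 0} := by
    refine DifferentiableOn.analyticOnNhd (fun z hz => ?_) hopen
    refine DifferentiableAt.differentiableWithinAt ?_
    refine DifferentiableAt.const_mul ?_ _
    refine differentiableAt_id.neg.cpow_const ?_
    left
    have : z.re < 0 := hz
    simpa using this
  have heq : ∀ r : ℝ, 0 < r → complexMGF id μ (-r : ℝ) =
      (Real.Gamma p : ℂ) * (-((-r : ℝ) : ℂ)) ^ (-p : ℂ) := by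
    intro r hr
    rw [hmgf]
    have h1 := Real.integral_rpow_mul_exp_neg_mul_Ioi hp hr
    have h2 : ∫ x : ℝ in Set.Ioi 0, ((x ^ (p - 1) : ℝ) : ℂ) * Complex.exp ((-r : ℝ) * x) =
        ((∫ x : ℝ in Set.Ioi 0, x ^ (p - 1) * Real.exp (-(r * x)) : ℝ) : ℂ) := by
      rw [← integral_complex_ofReal]
      refine setIntegral_congr_fun measurableSet_Ioi fun x hx => ?_
      push_cast
      simp
    rw [h2, h1, one_div, Real.inv_rpow hr.le, ← Real.rpow_neg hr.le]
    push_cast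
    rw [neg_neg, Complex.ofReal_cpow hr.le]
    push_cast
    ring
  have hfreq : ∃ᶠ z in 𝓝[≠] (-1 : ℂ), complexMGF id μ z =
      (Real.Gamma p : ℂ) * (-z) ^ (-p : ℂ) := by
    have hlim : Tendsto (fun r : ℝ => ((-r : ℝ) : ℂ)) (𝓝[≠] 1) (𝓝[≠] (-1 : ℂ)) := by
      refine tendsto_nhdsWithin_iff.2 ⟨?_, ?_⟩
      · have : Continuous fun r : ℝ => ((-r : ℝ) : ℂ) := by fun_prop
        simpa using (this.tendsto 1).mono_left nhdsWithin_le_nhds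
      · filter_upwards [self_mem_nhdsWithin] with r hr
        simp only [Set.mem_compl_iff, Set.mem_singleton_iff] at hr ⊢
        push_cast
        rw [neg_inj]
        exact_mod_cast hr
    refine hlim.frequently (Eventually.frequently ?_)
    have : ∀ᶠ r : ℝ in 𝓝[≠] 1, 0 < r :=
      mem_nhdsWithin_of_mem_nhds (lt_mem_nhds one_pos)
    filter_upwards [this] with r hr using heq r hr
  have hconv : IsPreconnected {z : ℂ | z.re < 0} :=
    (convex_halfSpace_re_lt 0).isPreconnected
  have := hanal.eqOn_of_preconnected_of_frequently_eq hanal' hconv (z₀ := -1) (by simp) hfreq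
    (x := -l) (by simpa using hl)
  simp only [neg_neg] at this
  rw [← this, hmgf]
  simp

end GammaIntegral

/-! ### The compensated exponential integral -/

section CompensatedExponential

variable {α : ℝ}

theorem norm_cexp_neg_sub_one_le {z : ℂ} (hz : 0 ≤ z.re) : ‖Complex.exp (-z) - 1‖ ≤ 2 * ‖z‖ := by
  rcases le_total ‖z‖ 1 with h | h
  · simpa using Complex.norm_exp_sub_one_le (x := -z) (by simpa using h)
  · have h1 : ‖Complex.exp (-z)‖ ≤ 1 := by
      rw [Complex.norm_exp]; simpa using hz
    calc ‖Complex.exp (-z) - 1‖ ≤ ‖Complex.exp (-z)‖ + ‖(1 : ℂ)‖ := norm_sub_le _ _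
      _ ≤ 2 * ‖z‖ := by rw [norm_one]; linarith

theorem norm_cexp_neg_sub_one_le_two {z : ℂ} (hz : 0 ≤ z.re) : ‖Complex.exp (-z) - 1‖ ≤ 2 := by
  have h1 : ‖Complex.exp (-z)‖ ≤ 1 := by
    rw [Complex.norm_exp]; simpa using hz
  calc ‖Complex.exp (-z) - 1‖ ≤ ‖Complex.exp (-z)‖ + ‖(1 : ℂ)‖ := norm_sub_le _ _
    _ ≤ 2 := by rw [norm_one]; linarith

theorem norm_cexp_neg_sub_one_add_le {z : ℂ} (hz : 0 ≤ z.re) :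
    ‖Complex.exp (-z) - 1 + z‖ ≤ 3 * ‖z‖ := by
  calc ‖Complex.exp (-z) - 1 + z‖ ≤ ‖Complex.exp (-z) - 1‖ + ‖z‖ := norm_add_le _ _
    _ ≤ 3 * ‖z‖ := by linarith [norm_cexp_neg_sub_one_le hz]

theorem norm_cexp_neg_sub_one_add_le_sq {z : ℂ} (hz : 0 ≤ z.re) :
    ‖Complex.exp (-z) - 1 + z‖ ≤ 3 * ‖z‖ ^ 2 := by
  rcases le_total ‖z‖ 1 with h | h
  · have := Complex.norm_exp_sub_one_sub_id_le (x := -z) (by simpa using h)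
    rw [sub_neg_eq_add, norm_neg] at this
    linarith [sq_nonneg ‖z‖]
  · refine (norm_cexp_neg_sub_one_add_le hz).trans ?_
    nlinarith

/-- The quadratic bound gives `x^(1-α)` near `0`, integrable since `α < 2`; the linear one gives
`x^(-α)` at infinity, integrable since `α > 1`. -/
theorem integrableOn_Ioi_rpow_of_bounds {f : ℝ → ℂ} (hf : AEStronglyMeasurable f) {C : ℝ}
    (hα1 : 1 < α) (hα2 : α < 2)
    (h0 : ∀ x : ℝ, 0 < x → ‖f x‖ ≤ C * x ^ 2) (h1 : ∀ x : ℝ, 0 < x → ‖f x‖ ≤ C * x) :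
    IntegrableOn (fun x : ℝ => f x * ((x ^ (-1 - α) : ℝ) : ℂ)) (Set.Ioi 0) := by
  have hm : AEStronglyMeasurable (fun x : ℝ => f x * ((x ^ (-1 - α) : ℝ) : ℂ)) :=
    hf.mul (Measurable.aestronglyMeasurable (by fun_prop))
  rw [← Set.Ioc_union_Ioi_eq_Ioi zero_le_one]
  refine IntegrableOn.union ?_ ?_
  · rw [integrableOn_Ioc_iff_integrableOn_Ioo]
    refine Integrable.mono' (((intervalIntegral.integrableOn_Ioo_rpow_iff (s := 1 - α)
      one_pos).2 (by linarith)).const_mul C) hm.restrict ?_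
    refine (ae_restrict_iff' measurableSet_Ioo).2 (.of_forall fun x hx => ?_)
    rw [norm_mul, Complex.norm_real, Real.norm_eq_abs, abs_of_nonneg (Real.rpow_nonneg hx.1.le _)]
    calc ‖f x‖ * x ^ (-1 - α) ≤ (C * x ^ 2) * x ^ (-1 - α) := by
          gcongr
          · exact Real.rpow_nonneg hx.1.le _
          · exact h0 x hx.1
      _ = C * x ^ (1 - α) := by
          rw [mul_assoc, ← Real.rpow_natCast, ← Real.rpow_add hx.1]
          norm_num
          left; ring_nf
  · refine Integrable.mono' ((integrableOn_Ioi_rpow_of_lt (a := -α) (by linarith)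
      one_pos).const_mul C) hm.restrict ?_
    refine (ae_restrict_iff' measurableSet_Ioi).2 (.of_forall fun x hx => ?_)
    have hx0 : (0 : ℝ) < x := one_pos.trans hx
    rw [norm_mul, Complex.norm_real, Real.norm_eq_abs, abs_of_nonneg (Real.rpow_nonneg hx0.le _)]
    calc ‖f x‖ * x ^ (-1 - α) ≤ (C * x) * x ^ (-1 - α) := by
          gcongr
          exact h1 x hx0
      _ = C * x ^ (-α) := by
          have : x * x ^ (-1 - α) = x ^ (-α) := by
            conv_lhs => rw [← Real.rpow_one x, ← Real.rpow_mul hx0.le, ← Real.rpow_add hx0]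
            congr 1; ring
          rw [mul_assoc, this]

theorem integrableOn_compensated_exp (hα1 : 1 < α) (hα2 : α < 2) {l : ℂ} (hl : 0 < l.re) :
    IntegrableOn (fun x : ℝ => (Complex.exp (-(l * x)) - 1 + l * x) * ((x ^ (-1 - α) : ℝ) : ℂ))
      (Set.Ioi 0) := by
  refine integrableOn_Ioi_rpow_of_bounds (C := 3 * max ‖l‖ (‖l‖ ^ 2))
    (Measurable.aestronglyMeasurable (by fun_prop)) hα1 hα2 (fun x hx => ?_) fun x hx => ?_
  · refine (norm_cexp_neg_sub_one_add_le_sq (by simp; positivity)).trans ?_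
    rw [norm_mul, Complex.norm_real, Real.norm_eq_abs, abs_of_pos hx, mul_pow, ← mul_assoc]
    gcongr
    exact le_max_right _ _
  · refine (norm_cexp_neg_sub_one_add_le (by simp; positivity)).trans ?_
    rw [norm_mul, Complex.norm_real, Real.norm_eq_abs, abs_of_pos hx, ← mul_assoc]
    gcongr
    exact le_max_left _ _

theorem integral_compensated_exp (hα1 : 1 < α) (hα2 : α < 2) {l : ℂ} (hl : 0 < l.re) :
    ∫ x : ℝ in Set.Ioi 0, (Complex.exp (-(l * x)) - 1 + l * x) * ((x ^ (-1 - α) : ℝ) : ℂ) =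
      (Real.Gamma (2 - α) / (α * (α - 1)) : ℝ) * l ^ (α : ℂ) := by
  have hα0 : (α : ℂ) ≠ 0 := by exact_mod_cast (by linarith : α ≠ 0)
  have hα1' : (α : ℂ) - 1 ≠ 0 := by
    have : ((α - 1 : ℝ) : ℂ) ≠ 0 := by exact_mod_cast (by linarith : α - 1 ≠ 0)
    simpa using this
  have hl0 : l ≠ 0 := by rintro rfl; simp at hl
  set κ : ℂ := 1 / ((α : ℂ) * (α - 1)) with hκ
  -- `A` collects the boundary terms of two integrations by parts, and `A'` is the integrand minus
  -- the Gamma integrand that remains. As `A` is `O(x^(2-α))` at `0` and `O(x^(1-α))` at infinity,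
  -- both boundary values vanish.
  set A : ℝ → ℂ := fun x => -((Complex.exp (-(l * x)) - 1 + l * x) * ((x ^ (-α) : ℝ) : ℂ) / α) +
    κ * (l * ((Complex.exp (-(l * x)) - 1) * ((x ^ (1 - α) : ℝ) : ℂ))) with hA
  set A' : ℝ → ℂ := fun x =>
    (Complex.exp (-(l * x)) - 1 + l * x) * ((x ^ (-1 - α) : ℝ) : ℂ) -
      κ * l ^ 2 * (((x ^ ((2 - α) - 1) : ℝ) : ℂ) * Complex.exp (-(l * x))) with hA'
  have hderiv : ∀ x ∈ Set.Ioi (0 : ℝ), HasDerivAt A (A' x) x := by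
    intro x hx
    have hx0 : (x : ℝ) ≠ 0 := ne_of_gt hx
    have hlin : HasDerivAt (fun x : ℝ => l * (x : ℂ)) l x := by
      simpa using (Complex.ofRealCLM.hasDerivAt (x := x)).const_mul l
    have hexp : HasDerivAt (fun x : ℝ => Complex.exp (-(l * x)))
        (Complex.exp (-(l * x)) * -l) x := hlin.neg.cexp
    have hp : ∀ q : ℝ, HasDerivAt (fun x : ℝ => ((x ^ q : ℝ) : ℂ))
        ((q * x ^ (q - 1) : ℝ) : ℂ) x := fun q =>
      (Real.hasDerivAt_rpow_const (.inl hx0)).ofReal_comp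
    have h1 := ((((hexp.sub_const 1).add hlin).mul (hp (-α))).div_const (α : ℂ)).neg.add
      ((((hexp.sub_const 1).mul (hp (1 - α))).const_mul l).const_mul κ)
    refine h1.congr_deriv ?_
    have e1 : -α - 1 = -1 - α := by ring
    have e2 : 1 - α - 1 = -α := by ring
    have e3 : 2 - α - 1 = 1 - α := by ring
    simp only [hA', hκ, e1, e2, e3, Pi.add_apply]
    push_cast
    field_simp
    ring
  have hint1 := integrableOn_compensated_exp hα1 hα2 hl
  have hint2 := (integrableOn_rpow_mul_cexp_neg (p := 2 - α) (by linarith) hl).const_mul (κ * l ^ 2)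
  have hA0 : A 0 = 0 := by simp [hA]
  have hbound : ∀ x : ℝ, 0 < x → 0 ≤ (l * x).re := fun x hx => by simp; positivity
  have hnx : ∀ x : ℝ, 0 < x → ‖l * (x : ℂ)‖ = ‖l‖ * x := fun x hx => by
    rw [norm_mul, Complex.norm_real, Real.norm_eq_abs, abs_of_pos hx]
  have hnr : ∀ x q : ℝ, 0 < x → ‖((x ^ q : ℝ) : ℂ)‖ = x ^ q := fun x q hx => by
    rw [Complex.norm_real, Real.norm_eq_abs, abs_of_nonneg (Real.rpow_nonneg hx.le _)]
  have hcont : ContinuousWithinAt A (Set.Ici 0) 0 := by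
    rw [← Set.Ioi_insert, continuousWithinAt_insert_self, ContinuousWithinAt, hA0]
    have hlim : Tendsto (fun x : ℝ => (3 * ‖l‖ ^ 2 / ‖(α : ℂ)‖ + ‖κ‖ * (‖l‖ * (2 * ‖l‖))) *
        x ^ (2 - α)) (𝓝[>] 0) (𝓝 0) := by
      have := (Real.continuousAt_rpow_const 0 (2 - α) (.inr (by linarith))).tendsto.mono_left
        (nhdsWithin_le_nhds (s := Set.Ioi 0))
      rw [Real.zero_rpow (by linarith)] at this
      simpa using this.const_mul (3 * ‖l‖ ^ 2 / ‖(α : ℂ)‖ + ‖κ‖ * (‖l‖ * (2 * ‖l‖)))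
    refine squeeze_zero_norm' ?_ hlim
    filter_upwards [self_mem_nhdsWithin] with x hx
    have hx : 0 < x := hx
    have e1 : x ^ (2 - α) = x ^ 2 * x ^ (-α) := by
      rw [← Real.rpow_natCast, ← Real.rpow_add hx]; norm_num; ring_nf
    have e2 : x ^ (2 - α) = x * x ^ (1 - α) := by
      conv_rhs => rw [← Real.rpow_one x, ← Real.rpow_mul hx.le, ← Real.rpow_add hx]
      congr 1; ring
    refine (norm_add_le _ _).trans ?_
    rw [norm_neg, norm_div, norm_mul, norm_mul, norm_mul, norm_mul, hnr x _ hx, hnr x _ hx, add_mul]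
    have b1 := norm_cexp_neg_sub_one_add_le_sq (hbound x hx)
    have b2 := norm_cexp_neg_sub_one_le (hbound x hx)
    rw [hnx x hx] at b1 b2
    refine add_le_add ?_ ?_
    · rw [e1, div_mul_eq_mul_div]
      refine div_le_div_of_nonneg_right ?_ (norm_nonneg _)
      calc _ ≤ 3 * (‖l‖ * x) ^ 2 * x ^ (-α) := by gcongr
        _ = _ := by ring
    · rw [e2]
      calc _ ≤ ‖κ‖ * (‖l‖ * (2 * (‖l‖ * x) * x ^ (1 - α))) := by gcongr
        _ = _ := by ring
  have htop : Tendsto A atTop (𝓝 0) := by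
    have hlim : Tendsto (fun x : ℝ => (3 * ‖l‖ / ‖(α : ℂ)‖ + ‖κ‖ * (‖l‖ * 2)) *
        x ^ (-(α - 1))) atTop (𝓝 0) := by
      simpa using (tendsto_rpow_neg_atTop (y := α - 1) (by linarith)).const_mul
        (3 * ‖l‖ / ‖(α : ℂ)‖ + ‖κ‖ * (‖l‖ * 2))
    refine squeeze_zero_norm' ?_ hlim
    filter_upwards [eventually_gt_atTop 0] with x hx
    have e1 : x ^ (-(α - 1)) = x * x ^ (-α) := by
      conv_rhs => rw [← Real.rpow_one x, ← Real.rpow_mul hx.le, ← Real.rpow_add hx]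
      congr 1; ring
    have e2 : -(α - 1) = 1 - α := by ring
    refine (norm_add_le _ _).trans ?_
    rw [norm_neg, norm_div, norm_mul, norm_mul, norm_mul, norm_mul, hnr x _ hx, hnr x _ hx, add_mul]
    have b1 := norm_cexp_neg_sub_one_add_le (hbound x hx)
    have b2 := norm_cexp_neg_sub_one_le_two (hbound x hx)
    rw [hnx x hx] at b1
    refine add_le_add ?_ ?_
    · rw [e1, div_mul_eq_mul_div]
      refine div_le_div_of_nonneg_right ?_ (norm_nonneg _)
      calc _ ≤ 3 * (‖l‖ * x) * x ^ (-α) := by gcongr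
        _ = _ := by ring
    · rw [e2]
      calc _ ≤ ‖κ‖ * (‖l‖ * (2 * x ^ (1 - α))) := by gcongr
        _ = _ := by ring
  have hftc := integral_Ioi_of_hasDerivAt_of_tendsto hcont hderiv (hint1.sub hint2) htop
  rw [hA0, sub_zero] at hftc
  simp only [hA'] at hftc
  rw [integral_sub hint1 hint2, sub_eq_zero, integral_const_mul,
    integral_rpow_mul_cexp_neg (p := 2 - α) (by linarith) hl] at hftc
  rw [hftc, hκ]
  have : l ^ (α : ℂ) = l ^ 2 * l ^ (-((2 - α : ℝ) : ℂ)) := by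
    rw [← Complex.cpow_natCast, ← Complex.cpow_add _ _ hl0]
    congr 1; push_cast; ring
  rw [this]
  push_cast
  field_simp

end CompensatedExponential

/-! ### The tilted Lévy measure and its characteristic function -/

section TiltedLevyMeasure

variable {α : ℝ}

theorem integrableOn_one_sub_cos_mul_rpow (hα1 : 1 < α) (hα2 : α < 2) :
    IntegrableOn (fun x : ℝ => (1 - Real.cos x) * x ^ (-1 - α)) (Set.Ioi 0) := by
  have hn : ∀ x : ℝ, ‖((1 - Real.cos x : ℝ) : ℂ)‖ = 1 - Real.cos x := fun x => by
    rw [Complex.norm_real, Real.norm_eq_abs, abs_of_nonneg (by linarith [Real.cos_le_one x])]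
  have h1 : ∀ x : ℝ, 1 - Real.cos x ≤ x ^ 2 / 2 := fun x => by
    linarith [Real.one_sub_sq_div_two_le_cos (x := x)]
  have := integrableOn_Ioi_rpow_of_bounds (α := α) (f := fun x : ℝ => ((1 - Real.cos x : ℝ) : ℂ))
    (C := 2) (Measurable.aestronglyMeasurable (by fun_prop)) hα1 hα2
    (fun x hx => by rw [hn]; linarith [h1 x, sq_nonneg x])
    (fun x hx => by
      rw [hn]
      rcases le_total x 1 with h | h
      · nlinarith [h1 x]
      · linarith [Real.neg_one_le_cos x])
  refine this.re.congr (.of_forall fun x => ?_)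
  simp only [← Complex.ofReal_mul]
  exact Complex.ofReal_re _

/-- Since `1 - cos x = 1 - e^{ix}/2 - e^{-ix}/2`, tilting is a second difference in `θ`. It
annihilates the affine compensator `-1 + lx`, leaving only the powers `l^α`. -/
theorem integral_cexp_mul_one_sub_cos_of_pos (hα1 : 1 < α) (hα2 : α < 2) (θ : ℝ) {ε : ℝ}
    (hε : 0 < ε) :
    ∫ x : ℝ in Set.Ioi 0, Complex.exp (-((ε - θ * Complex.I) * x)) *
        (((1 - Real.cos x) * x ^ (-1 - α) : ℝ) : ℂ) =
      (Real.Gamma (2 - α) / (α * (α - 1)) : ℝ) * ((ε - θ * Complex.I) ^ (α : ℂ) -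
        (1 / 2) * (ε - (θ + 1 : ℝ) * Complex.I) ^ (α : ℂ) -
        (1 / 2) * (ε - (θ - 1 : ℝ) * Complex.I) ^ (α : ℂ)) := by
  have hre : ∀ θ : ℝ, 0 < ((ε : ℂ) - θ * Complex.I).re := fun θ => by simpa using hε
  have hF := fun θ => integral_compensated_exp hα1 hα2 (hre θ)
  have hI := fun θ => integrableOn_compensated_exp hα1 hα2 (hre θ)
  have h12 := (hI θ).sub ((hI (θ + 1)).const_mul (1 / 2))
  simp only [Pi.sub_def] at h12
  rw [mul_sub, mul_sub, mul_left_comm, mul_left_comm _ (1 / 2 : ℂ), ← hF, ← hF, ← hF,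
    ← integral_const_mul, ← integral_const_mul,
    ← integral_sub (hI θ) ((hI (θ + 1)).const_mul _),
    ← integral_sub h12 ((hI (θ - 1)).const_mul _)]
  refine setIntegral_congr_fun measurableSet_Ioi fun x _ => ?_
  have e1 : Complex.exp (-((ε - (θ + 1 : ℝ) * Complex.I) * x)) =
      Complex.exp (-((ε - θ * Complex.I) * x)) * Complex.exp (x * Complex.I) := by
    rw [← Complex.exp_add]; congr 1; push_cast; ring
  have e2 : Complex.exp (-((ε - (θ - 1 : ℝ) * Complex.I) * x)) =
      Complex.exp (-((ε - θ * Complex.I) * x)) * Complex.exp (-x * Complex.I) := by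
    rw [← Complex.exp_add]; congr 1; push_cast; ring
  simp only [e1, e2]
  push_cast
  rw [Complex.cos]
  ring

/-- Let `ε → 0+`: the integrand is dominated by the tilted density, and the power is continuous on
the closed right half-plane because `α > 0`. -/
theorem integral_cexp_mul_one_sub_cos (hα1 : 1 < α) (hα2 : α < 2) (θ : ℝ) :
    ∫ x : ℝ in Set.Ioi 0, Complex.exp (θ * x * Complex.I) *
        (((1 - Real.cos x) * x ^ (-1 - α) : ℝ) : ℂ) =
      (Real.Gamma (2 - α) / (α * (α - 1)) : ℝ) * ((-(θ * Complex.I)) ^ (α : ℂ) -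
        (1 / 2) * (-((θ + 1 : ℝ) * Complex.I)) ^ (α : ℂ) -
        (1 / 2) * (-((θ - 1 : ℝ) * Complex.I)) ^ (α : ℂ)) := by
  have hlim1 : Tendsto (fun ε : ℝ => ∫ x : ℝ in Set.Ioi 0,
      Complex.exp (-((ε - θ * Complex.I) * x)) * (((1 - Real.cos x) * x ^ (-1 - α) : ℝ) : ℂ))
      (𝓝[>] 0) (𝓝 (∫ x : ℝ in Set.Ioi 0, Complex.exp (θ * x * Complex.I) *
        (((1 - Real.cos x) * x ^ (-1 - α) : ℝ) : ℂ))) := by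
    refine tendsto_integral_filter_of_dominated_convergence
      (fun x : ℝ => (1 - Real.cos x) * x ^ (-1 - α))
      (.of_forall fun ε => Measurable.aestronglyMeasurable (by fun_prop)) ?_
      (integrableOn_one_sub_cos_mul_rpow hα1 hα2) (.of_forall fun x => ?_)
    · filter_upwards [self_mem_nhdsWithin] with ε hε
      have hε : 0 < ε := hε
      refine (ae_restrict_iff' measurableSet_Ioi).2 (.of_forall fun x hx => ?_)
      have hx : 0 < x := hx
      have h0 : 0 ≤ (1 - Real.cos x) * x ^ (-1 - α) :=
        mul_nonneg (by linarith [Real.cos_le_one x]) (Real.rpow_nonneg hx.le _)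
      rw [norm_mul, Complex.norm_real, Real.norm_eq_abs, abs_of_nonneg h0]
      refine mul_le_of_le_one_left h0 ?_
      rw [Complex.norm_exp]
      simp
      positivity
    · refine Tendsto.mul_const _ ?_
      have hc : Continuous fun ε : ℝ => Complex.exp (-((ε - θ * Complex.I) * x)) := by fun_prop
      have := (hc.tendsto 0).mono_left (nhdsWithin_le_nhds (s := Set.Ioi 0))
      convert this using 3
      push_cast; ring_nf
  have hpow : ∀ θ : ℝ, Tendsto (fun ε : ℝ => ((ε : ℂ) - θ * Complex.I) ^ (α : ℂ)) (𝓝[>] 0)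
      (𝓝 ((-(θ * Complex.I)) ^ (α : ℂ))) := fun θ => by
    have hc : Continuous fun ε : ℝ => (ε : ℂ) - θ * Complex.I := by fun_prop
    have h1 := (hc.tendsto 0).mono_left (nhdsWithin_le_nhds (s := Set.Ioi 0))
    simp only [Complex.ofReal_zero, zero_sub] at h1
    refine Tendsto.comp (Complex.continuousAt_cpow_const_of_re_pos (.inl (by simp)) ?_) h1
    simp; linarith
  refine tendsto_nhds_unique hlim1 (Tendsto.congr' ?_
    ((((hpow θ).sub ((hpow (θ + 1)).const_mul _)).sub ((hpow (θ - 1)).const_mul _)).const_mul _))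
  filter_upwards [self_mem_nhdsWithin] with ε hε
  exact (integral_cexp_mul_one_sub_cos_of_pos hα1 hα2 θ hε).symm

/-- The principal argument of `-iθ` is `-sign(θ) π/2`. This turns `l^α` into the trigonometric form
of a stable exponent. -/
theorem neg_mul_I_cpow (hα : α ≠ 0) (θ : ℝ) :
    (-(θ * Complex.I)) ^ (α : ℂ) = (|θ| ^ α : ℝ) *
      (Real.cos (Real.pi * α / 2) - Real.sign θ * Real.sin (Real.pi * α / 2) * Complex.I) := by
  have hα' : (α : ℂ) ≠ 0 := by exact_mod_cast hα
  have key : ∀ (s : ℝ) (w : ℂ), w ≠ 0 → Complex.log w = -(s * (Real.pi / 2) * Complex.I) →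
      ∀ t : ℝ, 0 < t → (t * w) ^ (α : ℂ) = (t ^ α : ℝ) *
        (Real.cos (s * (Real.pi * α / 2)) - Real.sin (s * (Real.pi * α / 2)) * Complex.I) := by
    intro s w hw hlog t ht
    have ht' : (t : ℂ) ≠ 0 := by exact_mod_cast ht.ne'
    rw [Complex.cpow_def_of_ne_zero (mul_ne_zero ht' hw), Complex.log_ofReal_mul ht hw, hlog,
      add_mul, Complex.exp_add, Real.rpow_def_of_pos ht]
    have : -(s * (Real.pi / 2) * Complex.I) * (α : ℂ) =
        ((-(s * (Real.pi * α / 2)) : ℝ) : ℂ) * Complex.I := by push_cast; ring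
    rw [this, Complex.exp_mul_I, ← Complex.ofReal_cos, ← Complex.ofReal_sin, Real.cos_neg,
      Real.sin_neg]
    push_cast
    ring
  rcases lt_trichotomy θ 0 with h | rfl | h
  · have := key (-1) Complex.I Complex.I_ne_zero (by rw [Complex.log_I]; push_cast; ring) (-θ)
      (neg_pos.2 h)
    rw [Real.sign_of_neg h, abs_of_neg h]
    simp only [neg_mul, one_mul, Real.cos_neg, Real.sin_neg] at this
    rw [← neg_mul, ← Complex.ofReal_neg, this]
    push_cast
    ring
  · simp [Complex.zero_cpow hα', Real.zero_rpow hα]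
  · have := key 1 (-Complex.I) (neg_ne_zero.2 Complex.I_ne_zero)
      (by rw [Complex.log_neg_I]; push_cast; ring) θ h
    rw [Real.sign_of_pos h, abs_of_pos h, ← mul_neg, this]
    push_cast
    ring_nf

/-- The positive half of the stable Lévy measure, tilted by `1 - cos x`. -/
noncomputable def tiltedHalfMeasure (α : ℝ) : Measure ℝ :=
  (volume.restrict (Set.Ioi 0)).withDensity
    fun x => ENNReal.ofReal ((1 - Real.cos x) * x ^ (-1 - α))

/-- The stable Lévy measure with weights `cp` and `cm` on the half-lines, tilted by `1 - cos x`. -/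
noncomputable def tiltedLevyMeasure (α : ℝ) (cp cm : ℝ≥0) : Measure ℝ :=
  cp • tiltedHalfMeasure α + cm • (tiltedHalfMeasure α).map Neg.neg

theorem isFiniteMeasure_tiltedHalfMeasure (hα1 : 1 < α) (hα2 : α < 2) :
    IsFiniteMeasure (tiltedHalfMeasure α) :=
  isFiniteMeasure_withDensity_ofReal (integrableOn_one_sub_cos_mul_rpow hα1 hα2).2

theorem isFiniteMeasure_tiltedLevyMeasure (hα1 : 1 < α) (hα2 : α < 2) (cp cm : ℝ≥0) :
    IsFiniteMeasure (tiltedLevyMeasure α cp cm) := by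
  have := isFiniteMeasure_tiltedHalfMeasure hα1 hα2
  unfold tiltedLevyMeasure
  infer_instance

theorem charFun_tiltedHalfMeasure (hα1 : 1 < α) (hα2 : α < 2) (θ : ℝ) :
    charFun (tiltedHalfMeasure α) θ =
      (Real.Gamma (2 - α) / (α * (α - 1)) : ℝ) * ((-(θ * Complex.I)) ^ (α : ℂ) -
        (1 / 2) * (-((θ + 1 : ℝ) * Complex.I)) ^ (α : ℂ) -
        (1 / 2) * (-((θ - 1 : ℝ) * Complex.I)) ^ (α : ℂ)) := by
  rw [← integral_cexp_mul_one_sub_cos hα1 hα2, charFun_apply_real, tiltedHalfMeasure,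
    integral_withDensity_eq_integral_toReal_smul (by fun_prop)
      (.of_forall fun _ => ENNReal.ofReal_lt_top)]
  refine setIntegral_congr_fun measurableSet_Ioi fun x hx => ?_
  have hx : 0 < x := hx
  rw [ENNReal.toReal_ofReal (mul_nonneg (by linarith [Real.cos_le_one x])
    (Real.rpow_nonneg hx.le _)), Complex.real_smul, mul_comm]

theorem integrable_cexp_mul_I (μ : Measure ℝ) [IsFiniteMeasure μ] (θ : ℝ) :
    Integrable (fun x : ℝ => Complex.exp (θ * x * Complex.I)) μ := by
  refine Integrable.of_bound (C := 1) (Measurable.aestronglyMeasurable (by fun_prop))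
    (.of_forall fun x => ?_)
  rw [← Complex.ofReal_mul, Complex.norm_exp_ofReal_mul_I]

theorem charFun_tiltedLevyMeasure (hα1 : 1 < α) (hα2 : α < 2) (cp cm : ℝ≥0) (θ : ℝ) :
    charFun (tiltedLevyMeasure α cp cm) θ =
      cp * charFun (tiltedHalfMeasure α) θ + cm * charFun (tiltedHalfMeasure α) (-θ) := by
  have := isFiniteMeasure_tiltedHalfMeasure hα1 hα2
  simp only [charFun_apply_real, tiltedLevyMeasure]
  rw [integral_add_measure (integrable_cexp_mul_I _ θ) (integrable_cexp_mul_I _ θ),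
    integral_smul_nnreal_measure,
    integral_smul_nnreal_measure, integral_map (by fun_prop)
      (Measurable.aestronglyMeasurable (by fun_prop))]
  simp only [NNReal.smul_def, Complex.real_smul]
  simp

end TiltedLevyMeasure

/-! ### Weak convergence of finite measures -/

section FiniteLevyContinuity

/-- Lévy's continuity theorem for finite measures with a nonzero limit. -/
theorem finiteMeasure_tendsto_of_tendsto_charFun {μ : ℕ → FiniteMeasure ℝ} {μ₀ : FiniteMeasure ℝ}
    (h0 : μ₀ ≠ 0)
    (h : ∀ t, Tendsto (fun n => charFun (μ n : Measure ℝ) t) atTop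
      (𝓝 (charFun (μ₀ : Measure ℝ) t))) :
    Tendsto μ atTop (𝓝 μ₀) := by
  have hmass : Tendsto (fun n => (μ n).mass) atTop (𝓝 μ₀.mass) := by
    have h1 := h 0
    simp only [charFun_zero] at h1
    rw [← NNReal.tendsto_coe]
    have h2 := (Complex.continuous_re.tendsto _).comp h1
    simpa [Function.comp_def] using h2
  have hne : ∀ᶠ n in atTop, μ n ≠ 0 := by
    have : ∀ᶠ n in atTop, (μ n).mass ≠ 0 :=
      hmass.eventually_ne ((FiniteMeasure.mass_nonzero_iff _).2 h0)
    exact this.mono fun n hn => (FiniteMeasure.mass_nonzero_iff _).1 hn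
  have hchar : ∀ (ν : FiniteMeasure ℝ), ν ≠ 0 → ∀ t,
      charFun (ν.normalize : Measure ℝ) t = ((ν.mass⁻¹ : ℝ≥0) : ℂ) * charFun (ν : Measure ℝ) t := by
    intro ν hν t
    rw [FiniteMeasure.toMeasure_normalize_eq_of_nonzero ν hν, charFun_apply_real,
      charFun_apply_real, integral_smul_nnreal_measure, NNReal.smul_def, Complex.real_smul]
  rw [← FiniteMeasure.tendsto_normalize_iff_tendsto h0]
  refine ⟨ProbabilityMeasure.tendsto_of_tendsto_charFun fun t => ?_, hmass⟩
  rw [hchar μ₀ h0]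
  have hinv : Tendsto (fun n => (((μ n).mass⁻¹ : ℝ≥0) : ℂ)) atTop (𝓝 ((μ₀.mass⁻¹ : ℝ≥0) : ℂ)) := by
    have h1 := hmass.inv₀ ((FiniteMeasure.mass_nonzero_iff _).2 h0)
    exact ((Complex.continuous_ofReal.comp NNReal.continuous_coe).tendsto _).comp h1
  refine (hinv.mul (h t)).congr' ?_
  filter_upwards [hne] with n hn using (hchar _ hn t).symm

/-- Normalisation reduces this to the portmanteau theorem for probability measures; for a zero limit
the total masses already tend to `0`. -/
theorem finiteMeasure_tendsto_real_of_null_frontier {ι : Type*} {L : Filter ι}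
    {μ : ι → FiniteMeasure ℝ} {μ₀ : FiniteMeasure ℝ} (h : Tendsto μ L (𝓝 μ₀)) {E : Set ℝ}
    (hE : (μ₀ : Measure ℝ) (frontier E) = 0) :
    Tendsto (fun n => (μ n : Measure ℝ).real E) L (𝓝 ((μ₀ : Measure ℝ).real E)) := by
  have hmass : Tendsto (fun n => ((μ n).mass : ℝ)) L (𝓝 μ₀.mass) :=
    NNReal.tendsto_coe.2 h.mass
  by_cases h0 : μ₀ = 0
  · subst h0
    have : ((0 : FiniteMeasure ℝ) : Measure ℝ).real E = 0 := by simp [measureReal_def]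
    rw [this]
    refine squeeze_zero (fun _ => measureReal_nonneg) (fun n => ?_) (by simpa using hmass)
    exact measureReal_mono (Set.subset_univ E)
  · have h1 := (FiniteMeasure.tendsto_normalize_iff_tendsto h0).2 h
    have h2 := ProbabilityMeasure.tendsto_measure_of_null_frontier_of_tendsto h1.1 (E := E) (by
      rw [FiniteMeasure.normalize_eq_of_nonzero _ h0]
      have : μ₀ (frontier E) = 0 := by
        rw [FiniteMeasure.null_iff_toMeasure_null]
        exact hE
      rw [this, mul_zero])
    have h3 := h1.2.mul h2
    simp only [← FiniteMeasure.self_eq_mass_mul_normalize] at h3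
    exact NNReal.tendsto_coe.2 h3

/-- Weak convergence survives multiplication by a bounded continuous density, so the set `E` may be
tested after weighting by `g`. This is how the tilt is removed later. -/
theorem tendsto_setIntegral_of_tendsto_charFun {μ : ℕ → Measure ℝ} {μ₀ : Measure ℝ}
    [∀ n, IsFiniteMeasure (μ n)] [IsFiniteMeasure μ₀] (h0 : μ₀ ≠ 0)
    (h : ∀ t, Tendsto (fun n => charFun (μ n) t) atTop (𝓝 (charFun μ₀ t)))
    {g : ℝ → ℝ} (hg : Continuous g) (hg0 : ∀ x, 0 ≤ g x) {C : ℝ} (hgC : ∀ x, g x ≤ C)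
    {E : Set ℝ} (hEm : MeasurableSet E) (hE : μ₀ (frontier E) = 0) :
    Tendsto (fun n => ∫ x in E, g x ∂μ n) atTop (𝓝 (∫ x in E, g x ∂μ₀)) := by
  have hint : ∀ (ν : Measure ℝ) [IsFiniteMeasure ν], Integrable g ν := fun ν _ =>
    Integrable.of_bound hg.aestronglyMeasurable C
      (.of_forall fun x => by rw [Real.norm_eq_abs, abs_of_nonneg (hg0 x)]; exact hgC x)
  have hfin : ∀ (ν : Measure ℝ) [IsFiniteMeasure ν],
      IsFiniteMeasure (ν.withDensity fun x => ENNReal.ofReal (g x)) := fun ν _ =>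
    isFiniteMeasure_withDensity_ofReal (hint ν).2
  have hreal : ∀ (ν : Measure ℝ) [IsFiniteMeasure ν],
      (ν.withDensity fun x => ENNReal.ofReal (g x)).real E = ∫ x in E, g x ∂ν := fun ν _ => by
    rw [measureReal_def, withDensity_apply _ hEm, integral_eq_lintegral_of_nonneg_ae
      (.of_forall hg0) hg.aestronglyMeasurable]
  obtain ⟨M, hM⟩ : ∃ M : ℕ → FiniteMeasure ℝ, ∀ n, (M n : Measure ℝ) = μ n :=
    ⟨fun n => ⟨μ n, inferInstance⟩, fun _ => rfl⟩
  obtain ⟨M₀, hM₀⟩ : ∃ M₀ : FiniteMeasure ℝ, (M₀ : Measure ℝ) = μ₀ :=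
    ⟨⟨μ₀, inferInstance⟩, rfl⟩
  obtain ⟨N, hN⟩ : ∃ N : ℕ → FiniteMeasure ℝ, ∀ n, (N n : Measure ℝ) =
      (μ n).withDensity fun x => ENNReal.ofReal (g x) :=
    ⟨fun n => ⟨_, hfin (μ n)⟩, fun _ => rfl⟩
  obtain ⟨N₀, hN₀⟩ : ∃ N₀ : FiniteMeasure ℝ, (N₀ : Measure ℝ) =
      μ₀.withDensity fun x => ENNReal.ofReal (g x) :=
    ⟨⟨_, hfin μ₀⟩, rfl⟩
  have hμ : Tendsto M atTop (𝓝 M₀) := by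
    refine finiteMeasure_tendsto_of_tendsto_charFun (fun h => h0 ?_) (by simpa only [hM, hM₀] using h)
    rw [← hM₀, h, FiniteMeasure.toMeasure_zero]
  have hν : Tendsto N atTop (𝓝 N₀) := by
    rw [FiniteMeasure.tendsto_iff_forall_integral_tendsto] at hμ ⊢
    intro f
    have hb : ∀ x, ‖g x * f x‖ ≤ C * ‖f‖ := fun x => by
      rw [norm_mul, Real.norm_eq_abs, abs_of_nonneg (hg0 x)]
      exact mul_le_mul (hgC x) (f.norm_coe_le_norm x) (norm_nonneg _) ((hg0 x).trans (hgC x))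
    have h1 := hμ (BoundedContinuousFunction.ofNormedAddCommGroup (fun x => g x * f x)
      (hg.mul f.continuous) _ hb)
    have h2 : ∀ ν : Measure ℝ, ∫ x, f x ∂(ν.withDensity fun x => ENNReal.ofReal (g x)) =
        ∫ x, g x * f x ∂ν := fun ν => by
      rw [integral_withDensity_eq_integral_toReal_smul (by fun_prop)
        (.of_forall fun _ => ENNReal.ofReal_lt_top)]
      simp only [ENNReal.toReal_ofReal (hg0 _), smul_eq_mul]
    simp only [hM, hM₀] at h1
    simp only [hN, hN₀, h2]
    exact h1
  have := finiteMeasure_tendsto_real_of_null_frontier hν (E := E)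
    (by rw [hN₀]; exact withDensity_absolutelyContinuous _ _ hE)
  simpa only [hN, hN₀, hreal] using this

theorem isFiniteMeasure_withDensity_one_sub_cos (μ : Measure ℝ) [IsFiniteMeasure μ] (c : ℝ) :
    IsFiniteMeasure (μ.withDensity fun x => ENNReal.ofReal ((1 - Real.cos x) * c)) := by
  refine isFiniteMeasure_withDensity_ofReal (Integrable.of_bound (C := 2 * |c|)
    (Measurable.aestronglyMeasurable (by fun_prop)) (.of_forall fun x => ?_)).2
  rw [norm_mul, Real.norm_eq_abs, Real.norm_eq_abs]
  gcongr
  rw [abs_of_nonneg (by linarith [Real.cos_le_one x])]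
  linarith [Real.neg_one_le_cos x]

theorem charFun_withDensity_one_sub_cos (μ : Measure ℝ) [IsFiniteMeasure μ] {c : ℝ} (hc : 0 ≤ c)
    (θ : ℝ) :
    charFun (μ.withDensity fun x => ENNReal.ofReal ((1 - Real.cos x) * c)) θ =
      c * (charFun μ θ - (1 / 2) * charFun μ (θ + 1) - (1 / 2) * charFun μ (θ - 1)) := by
  have h12 := (integrable_cexp_mul_I μ θ).sub ((integrable_cexp_mul_I μ (θ + 1)).const_mul (1 / 2))
  simp only [Pi.sub_def] at h12
  simp only [charFun_apply_real]
  rw [integral_withDensity_eq_integral_toReal_smul (by fun_prop)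
      (.of_forall fun _ => ENNReal.ofReal_lt_top), ← integral_const_mul, ← integral_const_mul,
    ← integral_sub (integrable_cexp_mul_I μ θ) ((integrable_cexp_mul_I μ (θ + 1)).const_mul _),
    ← integral_sub h12 ((integrable_cexp_mul_I μ (θ - 1)).const_mul _), ← integral_const_mul]
  refine integral_congr_ae (.of_forall fun x => ?_)
  have e1 : Complex.exp ((θ + 1 : ℝ) * x * Complex.I) =
      Complex.exp (θ * x * Complex.I) * Complex.exp (x * Complex.I) := by
    rw [← Complex.exp_add]; congr 1; push_cast; ring
  have e2 : Complex.exp ((θ - 1 : ℝ) * x * Complex.I) =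
      Complex.exp (θ * x * Complex.I) * Complex.exp (-x * Complex.I) := by
    rw [← Complex.exp_add]; congr 1; push_cast; ring
  simp only [e1, e2]
  rw [ENNReal.toReal_ofReal (mul_nonneg (by linarith [Real.cos_le_one x]) hc), Complex.real_smul]
  push_cast
  rw [Complex.cos]
  ring

end FiniteLevyContinuity

/-! ### Scaled mass of the annulus `(y, 2y]` -/

section Annulus

variable {α : ℝ}

/-- This is the derivative of `s ↦ exp(-s w)` at `0`, taken along `s = y^(-α)`. -/
theorem tendsto_rpow_mul_cexp_sub_one (hα : 0 < α) (w : ℂ) :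
    Tendsto (fun y : ℝ => ((y ^ α : ℝ) : ℂ) * (Complex.exp (-((y ^ (-α) : ℝ) * w)) - 1)) atTop
      (𝓝 (-w)) := by
  have h1 : HasDerivAt (fun s : ℝ => Complex.exp (-(s * w))) (-w) 0 := by
    have : HasDerivAt (fun s : ℝ => -((s : ℂ) * w)) (-w) 0 := by
      simpa using ((Complex.ofRealCLM.hasDerivAt (x := 0)).mul_const w).fun_neg
    simpa using this.cexp
  have h2 : Tendsto (fun y : ℝ => y ^ (-α)) atTop (𝓝[≠] 0) := by
    refine tendsto_nhdsWithin_iff.2 ⟨tendsto_rpow_neg_atTop hα, ?_⟩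
    filter_upwards [eventually_gt_atTop 0] with y hy using (Real.rpow_pos_of_pos hy _).ne'
  refine (h1.tendsto_slope.comp h2).congr' ?_
  filter_upwards [eventually_gt_atTop 0] with y hy
  simp only [Function.comp_def, slope, vsub_eq_sub, sub_zero]
  rw [Real.rpow_neg hy.le, inv_inv, Complex.real_smul]
  simp

theorem tendsto_rpow_mul_measureReal_Ioc (hα1 : 1 < α) (hα2 : α < 2) {cp cm : ℝ≥0} (hcp : 0 < cp)
    {Q : Measure ℝ} [IsProbabilityMeasure Q] {ψ : ℝ → ℂ}
    (hQ : ∀ θ, charFun Q θ = Complex.exp (-ψ θ))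
    (hψ : ∀ y θ : ℝ, 0 < y → ψ (y⁻¹ * θ) = (y ^ (-α) : ℝ) * ψ θ)
    (hν : ∀ θ, charFun (tiltedLevyMeasure α cp cm) θ =
      -ψ θ + (1 / 2) * ψ (θ + 1) + (1 / 2) * ψ (θ - 1)) :
    Tendsto (fun y : ℝ => y ^ α * Q.real (Set.Ioc y (2 * y))) atTop
      (𝓝 (cp / α * (1 - 2 ^ (-α)))) := by
  have hα0 : 0 < α := by linarith
  have hmap : ∀ y : ℝ, IsProbabilityMeasure (Q.map (y⁻¹ * ·)) := fun y =>
    Measure.isProbabilityMeasure_map (by fun_prop)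
  have hfin0 := isFiniteMeasure_tiltedLevyMeasure hα1 hα2 cp cm
  -- On `(1, 2]` one has `cos x ≤ cos 1`, so there `g` is exactly `1 / (1 - cos x)`; truncation at
  -- `κ` keeps it bounded and continuous on the whole line.
  set κ : ℝ := 1 - Real.cos 1 with hκ
  have hκ0 : 0 < κ := by
    have := Real.cos_one_le
    linarith
  set g : ℝ → ℝ := fun x => (max (1 - Real.cos x) κ)⁻¹ with hg
  have hmax : ∀ x, 0 < max (1 - Real.cos x) κ := fun x => lt_max_of_lt_right hκ0
  have hgc : Continuous g := by
    refine Continuous.inv₀ (by fun_prop) fun x => (hmax x).ne'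
  have hg0 : ∀ x, 0 ≤ g x := fun x => (inv_pos.2 (hmax x)).le
  have hgC : ∀ x, g x ≤ κ⁻¹ := fun x => inv_anti₀ hκ0 (le_max_right _ _)
  have hg1 : ∀ x ∈ Set.Ioc (1 : ℝ) 2, (1 - Real.cos x) * g x = 1 := by
    intro x hx
    have hle : Real.cos x ≤ Real.cos 1 := Real.cos_le_cos_of_nonneg_of_le_pi (by norm_num)
      (hx.2.trans (by linarith [Real.pi_gt_three])) hx.1.le
    have h1 : κ ≤ 1 - Real.cos x := by rw [hκ]; linarith
    simp only [hg]
    rw [max_eq_left h1]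
    exact mul_inv_cancel₀ (hκ0.trans_le h1).ne'
  have hdens : ∀ (ν : Measure ℝ) [IsFiniteMeasure ν] (w : ℝ → ℝ), Measurable w →
      (∀ x ∈ Set.Ioc (1 : ℝ) 2, 0 ≤ w x) →
      ∫ x in Set.Ioc 1 2, g x ∂(ν.withDensity fun x => ENNReal.ofReal ((1 - Real.cos x) * w x)) =
        ∫ x in Set.Ioc 1 2, w x ∂ν := by
    intro ν _ w hw hw0
    rw [setIntegral_withDensity_eq_setIntegral_toReal_smul (by fun_prop)
      (.of_forall fun _ => ENNReal.ofReal_lt_top) _ measurableSet_Ioc]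
    refine setIntegral_congr_fun measurableSet_Ioc fun x hx => ?_
    have h1 : 0 ≤ 1 - Real.cos x := by linarith [Real.cos_le_one x]
    simp only [ENNReal.toReal_ofReal (mul_nonneg h1 (hw0 x hx)), smul_eq_mul]
    rw [mul_right_comm, hg1 x hx, one_mul]
  set μ₀ := tiltedLevyMeasure α cp cm with hμ₀
  have hfinH := isFiniteMeasure_tiltedHalfMeasure hα1 hα2
  have hrestrict : μ₀.restrict (Set.Ioc 1 2) = cp • (tiltedHalfMeasure α).restrict (Set.Ioc 1 2) := by
    have hz : ((tiltedHalfMeasure α).map Neg.neg).restrict (Set.Ioc 1 2) = 0 := by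
      rw [Measure.restrict_eq_zero, Measure.map_apply measurable_neg measurableSet_Ioc]
      refine withDensity_absolutelyContinuous _ _ ?_
      rw [Measure.restrict_apply (measurable_neg measurableSet_Ioc)]
      convert measure_empty (μ := (volume : Measure ℝ))
      ext x
      simp only [Set.mem_inter_iff, Set.mem_preimage, Set.mem_Ioc, Set.mem_Ioi,
        Set.mem_empty_iff_false, iff_false]
      rintro ⟨⟨h1, -⟩, h2⟩
      linarith
    rw [hμ₀, tiltedLevyMeasure, Measure.restrict_add, Measure.restrict_smul, Measure.restrict_smul,
      hz, smul_zero, add_zero]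
  have hlimval : ∫ x in Set.Ioc 1 2, g x ∂μ₀ = cp / α * (1 - 2 ^ (-α)) := by
    rw [hrestrict, integral_smul_nnreal_measure, tiltedHalfMeasure]
    have h1 : ∫ x in Set.Ioc 1 2, g x ∂((volume.restrict (Set.Ioi 0)).withDensity
        fun x => ENNReal.ofReal ((1 - Real.cos x) * x ^ (-1 - α))) =
        ∫ x in (1 : ℝ)..2, x ^ (-1 - α) := by
      rw [setIntegral_withDensity_eq_setIntegral_toReal_smul (by fun_prop)
        (.of_forall fun _ => ENNReal.ofReal_lt_top) _ measurableSet_Ioc,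
        Measure.restrict_restrict measurableSet_Ioc,
        intervalIntegral.integral_of_le one_le_two]
      have : Set.Ioc (1 : ℝ) 2 ∩ Set.Ioi 0 = Set.Ioc 1 2 :=
        Set.inter_eq_left.2 fun x hx => one_pos.trans hx.1
      rw [this]
      refine setIntegral_congr_fun measurableSet_Ioc fun x hx => ?_
      have hx0 : 0 < x := one_pos.trans hx.1
      have h1 : 0 ≤ 1 - Real.cos x := by linarith [Real.cos_le_one x]
      simp only [ENNReal.toReal_ofReal (mul_nonneg h1 (Real.rpow_nonneg hx0.le _)), smul_eq_mul]
      rw [mul_right_comm, hg1 x hx, one_mul]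
    rw [h1, integral_rpow (.inr ⟨by linarith, by
      rw [Set.uIcc_of_le one_le_two]; intro h; linarith [h.1]⟩), Real.one_rpow, NNReal.smul_def,
      smul_eq_mul]
    have : -1 - α + 1 = -α := by ring
    rw [this]
    field_simp
    ring
  have hpos : 0 < (cp : ℝ) / α * (1 - 2 ^ (-α)) := by
    have : (2 : ℝ) ^ (-α) < 1 := Real.rpow_lt_one_of_one_lt_of_neg one_lt_two (by linarith)
    have h2 : (0 : ℝ) < cp := hcp
    have h3 : 0 < 1 - (2 : ℝ) ^ (-α) := by linarith
    positivity
  have hne : μ₀ ≠ 0 := by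
    intro h
    rw [h] at hlimval
    simp only [Measure.restrict_zero, integral_zero_measure] at hlimval
    exact hpos.ne hlimval
  have hfront : μ₀ (frontier (Set.Ioc 1 2)) = 0 := by
    have hac : tiltedHalfMeasure α ≪ volume :=
      (withDensity_absolutelyContinuous _ _).trans Measure.restrict_le_self.absolutelyContinuous
    rw [frontier_Ioc one_lt_two, hμ₀, tiltedLevyMeasure, Measure.add_apply, Measure.smul_apply,
      Measure.smul_apply, Measure.map_apply measurable_neg (Set.toFinite _).measurableSet]
    have e1 : tiltedHalfMeasure α {1, 2} = 0 := hac ((Set.toFinite _).measure_zero _)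
    have e2 : tiltedHalfMeasure α (Neg.neg ⁻¹' {1, 2}) = 0 :=
      hac (((Set.toFinite _).preimage neg_injective.injOn).measure_zero _)
    rw [e1, e2, smul_zero, smul_zero, add_zero]
  rw [← hlimval, tendsto_iff_seq_tendsto]
  intro y hy
  have hfinn : ∀ n, IsFiniteMeasure ((Q.map ((y n)⁻¹ * ·)).withDensity
      fun x => ENNReal.ofReal ((1 - Real.cos x) * y n ^ α)) := fun n =>
    isFiniteMeasure_withDensity_one_sub_cos _ _
  have hchar : ∀ θ, Tendsto (fun n => charFun ((Q.map ((y n)⁻¹ * ·)).withDensity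
      fun x => ENNReal.ofReal ((1 - Real.cos x) * y n ^ α)) θ) atTop (𝓝 (charFun μ₀ θ)) := by
    intro θ
    -- The `-1` inserted in each term is harmless: the weights `1, -1/2, -1/2` sum to zero.
    have hl := fun θ => (tendsto_rpow_mul_cexp_sub_one hα0 (ψ θ)).comp hy
    have h1 := ((hl θ).sub ((hl (θ + 1)).const_mul (1 / 2))).sub ((hl (θ - 1)).const_mul (1 / 2))
    have e1 : -ψ θ - 1 / 2 * -ψ (θ + 1) - 1 / 2 * -ψ (θ - 1) = charFun μ₀ θ := by
      rw [hν]; ring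
    rw [e1] at h1
    refine h1.congr' ?_
    filter_upwards [hy.eventually_gt_atTop 0] with n hn
    rw [charFun_withDensity_one_sub_cos _ (Real.rpow_nonneg hn.le _), charFun_map_mul,
      charFun_map_mul, charFun_map_mul, hQ, hQ, hQ, hψ _ _ hn, hψ _ _ hn, hψ _ _ hn]
    simp only [Function.comp_def]
    ring
  refine (tendsto_setIntegral_of_tendsto_charFun hne hchar hgc hg0 hgC measurableSet_Ioc
    hfront).congr' ?_
  filter_upwards [hy.eventually_gt_atTop 0] with n hn
  rw [hdens _ (fun _ => y n ^ α) measurable_const fun _ _ => Real.rpow_nonneg hn.le _,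
    setIntegral_const, smul_eq_mul, map_measureReal_apply (by fun_prop) measurableSet_Ioc, mul_comm]
  simp only [Function.comp_def]
  congr 2
  ext x
  simp only [Set.mem_preimage, Set.mem_Ioc]
  rw [lt_inv_mul_iff₀ hn, inv_mul_le_iff₀ hn, mul_one, mul_comm]

end Annulus

/-! ### From annuli to tails, and the tail of a stable law -/

section Tails

variable {α : ℝ}

/-- Dyadic increments determine the tail of a decreasing function that vanishes at infinity. -/
theorem tendsto_rpow_mul_of_dyadic {G : ℝ → ℝ} (hα : 0 < α) (hG : Antitone G)
    (hG0 : Tendsto G atTop (𝓝 0)) {K : ℝ}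
    (h : Tendsto (fun y => y ^ α * (G y - G (2 * y))) atTop (𝓝 K)) :
    Tendsto (fun y => y ^ α * G y) atTop (𝓝 (K / (1 - 2 ^ (-α)))) := by
  set r : ℝ := 2 ^ (-α) with hr
  have hr0 : 0 < r := by positivity
  have hr1 : r < 1 := Real.rpow_lt_one_of_one_lt_of_neg one_lt_two (by linarith)
  have h1r : 0 < 1 - r := by linarith
  rw [Metric.tendsto_atTop] at h ⊢
  intro ε hε
  -- Summed against `r^k`, an error of `ε (1 - r) / 2` per annulus becomes `ε / 2`.
  obtain ⟨Y, hY⟩ := h (ε * (1 - r) / 2) (by positivity)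
  refine ⟨max Y 1, fun y hy => ?_⟩
  have hyY : Y ≤ y := (le_max_left _ _).trans hy
  have hy1 : 1 ≤ y := (le_max_right _ _).trans hy
  have hy0 : 0 < y := by linarith
  have hmono : ∀ k : ℕ, y ≤ 2 ^ k * y := fun k =>
    le_mul_of_one_le_left hy0.le (one_le_pow₀ one_le_two)
  have hsum : HasSum (fun k : ℕ => G (2 ^ k * y) - G (2 ^ (k + 1) * y)) (G y) := by
    rw [hasSum_iff_tendsto_nat_of_nonneg]
    · have h1 : ∀ n, ∑ k ∈ Finset.range n, (G (2 ^ k * y) - G (2 ^ (k + 1) * y)) =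
          G y - G (2 ^ n * y) := fun n => by
        rw [Finset.sum_range_sub' (fun k => G (2 ^ k * y))]
        simp
      simp only [h1]
      have h2 : Tendsto (fun n : ℕ => (2 : ℝ) ^ n * y) atTop atTop :=
        (tendsto_pow_atTop_atTop_of_one_lt one_lt_two).atTop_mul_const hy0
      simpa using tendsto_const_nhds.sub (hG0.comp h2)
    · intro k
      refine sub_nonneg.2 (hG ?_)
      gcongr
      · exact one_le_two
      · exact Nat.le_succ k
  have hsum' := hsum.mul_left (y ^ α)
  have hgeom : ∀ c : ℝ, HasSum (fun k : ℕ => c * r ^ k) (c * (1 - r)⁻¹) := fun c =>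
    (hasSum_geometric_of_lt_one hr0.le hr1).mul_left c
  -- Rescaling the `k`-th annulus to base point `2^k y` costs a factor `r^k`, whence the geometric
  -- factor `1 / (1 - r)`.
  have hterm : ∀ k : ℕ, y ^ α * (G (2 ^ k * y) - G (2 ^ (k + 1) * y)) =
      ((2 ^ k * y) ^ α * (G (2 ^ k * y) - G (2 * (2 ^ k * y)))) * r ^ k := fun k => by
    have e1 : ((2 : ℝ) ^ k * y) ^ α = ((2 : ℝ) ^ α) ^ k * y ^ α := by
      rw [Real.mul_rpow (by positivity) hy0.le, ← Real.rpow_natCast, ← Real.rpow_mul zero_le_two,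
        mul_comm (k : ℝ) α, Real.rpow_mul zero_le_two, Real.rpow_natCast]
    have e2 : ((2 : ℝ) ^ α) ^ k * r ^ k = 1 := by
      rw [← mul_pow, hr, ← Real.rpow_add two_pos, add_neg_cancel, Real.rpow_zero, one_pow]
    rw [e1, pow_succ']
    calc _ = (((2 : ℝ) ^ α) ^ k * r ^ k) * (y ^ α * (G (2 ^ k * y) - G (2 * 2 ^ k * y))) := by
          rw [e2, one_mul]
      _ = _ := by rw [mul_assoc 2]; ring
  have hb : ∀ k : ℕ, |(2 ^ k * y) ^ α * (G (2 ^ k * y) - G (2 * (2 ^ k * y))) - K| <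
      ε * (1 - r) / 2 := fun k => hY _ (hyY.trans (hmono k))
  have hle : y ^ α * G y ≤ (K + ε * (1 - r) / 2) * (1 - r)⁻¹ :=
    hasSum_le (fun k => by
      rw [hterm]
      exact mul_le_mul_of_nonneg_right (by linarith [(abs_lt.1 (hb k)).2]) (by positivity))
      hsum' (hgeom _)
  have hge : (K - ε * (1 - r) / 2) * (1 - r)⁻¹ ≤ y ^ α * G y :=
    hasSum_le (fun k => by
      rw [hterm]
      exact mul_le_mul_of_nonneg_right (by linarith [(abs_lt.1 (hb k)).1]) (by positivity))
      (hgeom _) hsum'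
  rw [Real.dist_eq, abs_lt]
  have e1 : (K + ε * (1 - r) / 2) * (1 - r)⁻¹ = K / (1 - r) + ε / 2 := by field_simp
  have e2 : (K - ε * (1 - r) / 2) * (1 - r)⁻¹ = K / (1 - r) - ε / 2 := by field_simp
  rw [e1] at hle
  rw [e2] at hge
  constructor <;> linarith

theorem tendsto_measureReal_Ioi_atTop (ν : Measure ℝ) [IsFiniteMeasure ν] :
    Tendsto (fun u => ν.real (Set.Ioi u)) atTop (𝓝 0) := by
  have h := tendsto_measure_iInter_atTop (μ := ν) (s := fun u : ℝ => Set.Ioi u)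
    (fun _ => measurableSet_Ioi.nullMeasurableSet) (fun _ _ h => Set.Ioi_subset_Ioi h)
    ⟨0, measure_ne_top _ _⟩
  have he : ⋂ u : ℝ, Set.Ioi u = ∅ := by
    ext x
    simp only [Set.mem_iInter, Set.mem_Ioi, Set.mem_empty_iff_false, iff_false, not_forall]
    exact ⟨x, lt_irrefl x⟩
  rw [he, measure_empty] at h
  simpa [measureReal_def, Function.comp_def] using (ENNReal.tendsto_toReal ENNReal.zero_ne_top).comp h

/-- A regularly varying tail is long-tailed. -/
theorem isLongTailed_of_tendsto_rpow_mul {ν : Measure ℝ} [IsFiniteMeasure ν] {K : ℝ} (hK : 0 < K)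
    (h : Tendsto (fun u => u ^ α * ν.real (Set.Ioi u)) atTop (𝓝 K)) : IsLongTailed ν := by
  have hpos : ∀ u : ℝ, 0 < ν.real (Set.Ioi u) := fun u => by
    obtain ⟨v, hv, hv0, huv⟩ := ((h.eventually_const_lt hK).and
      ((eventually_gt_atTop 0).and (eventually_ge_atTop u))).exists
    have h1 : 0 < ν.real (Set.Ioi v) := pos_of_mul_pos_right hv (Real.rpow_nonneg hv0.le _)
    exact h1.trans_le (measureReal_mono (Set.Ioi_subset_Ioi huv))
  -- Since `u + √u = u (1 + 1/√u)`, the shift by `√u` changes `u^α` by a factor tending to `1`.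
  refine ⟨hpos, Real.sqrt, ?_, Real.tendsto_sqrt_atTop, ?_⟩
  · simpa only [Real.div_sqrt] using Real.tendsto_sqrt_atTop
  · rw [isEquivalent_iff_tendsto_one (.of_forall fun u => (hpos u).ne')]
    have hadd : Tendsto (fun u : ℝ => u + √u) atTop atTop :=
      tendsto_atTop_mono (fun u => le_add_of_nonneg_right (Real.sqrt_nonneg u)) tendsto_id
    have h1 := (h.comp hadd).div h hK.ne'
    have h2 : Tendsto (fun u : ℝ => (1 + (√u)⁻¹) ^ α) atTop (𝓝 1) := by
      have h3 : Tendsto (fun u : ℝ => 1 + (√u)⁻¹) atTop (𝓝 1) := by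
        simpa using (tendsto_inv_atTop_zero.comp Real.tendsto_sqrt_atTop).const_add (1 : ℝ)
      have := (Real.continuousAt_rpow_const 1 α (.inl one_ne_zero)).tendsto.comp h3
      simpa [Function.comp_def] using this
    have h4 := h1.div h2 one_ne_zero
    rw [div_self hK.ne', div_one] at h4
    refine h4.congr' ?_
    filter_upwards [eventually_gt_atTop 0] with u hu
    have hs : 0 < √u := Real.sqrt_pos.2 hu
    have e : u + √u = u * (1 + (√u)⁻¹) := by
      have := Real.mul_self_sqrt hu.le
      field_simp
      nlinarith
    have hu' := (Real.rpow_pos_of_pos hu α).ne'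
    have hs' : (1 + (√u)⁻¹) ^ α ≠ 0 := (Real.rpow_pos_of_pos (by positivity) α).ne'
    have hp := (hpos u).ne'
    have e' : (u + √u) ^ α = u ^ α * (1 + (√u)⁻¹) ^ α := by
      rw [e, Real.mul_rpow hu.le (by positivity)]
    simp only [Pi.div_apply, Function.comp_def]
    rw [e']
    field_simp

theorem cos_pi_mul_div_two_neg (hα1 : 1 < α) (hα2 : α < 2) : Real.cos (Real.pi * α / 2) < 0 := by
  refine Real.cos_neg_of_pi_div_two_lt_of_lt ?_ ?_ <;> nlinarith [Real.pi_pos]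

/-- The right tail of a stable law with index in `(1, 2)`. -/
theorem IsStableLaw.tendsto_rpow_mul_measureReal_Ioi {Q : Measure ℝ} [IsProbabilityMeasure Q]
    {σ β : ℝ} (hα1 : 1 < α) (hα2 : α < 2) (hσ : 0 < σ) (hβ1 : -1 < β) (hβ2 : β ≤ 1)
    (hQ : IsStableLaw Q α σ β 0) :
    Tendsto (fun y => y ^ α * Q.real (Set.Ioi y)) atTop
      (𝓝 ((1 - α) / (Real.Gamma (2 - α) * Real.cos (Real.pi * α / 2)) * ((1 + β) / 2) *
        σ ^ α)) := by
  have hcos := cos_pi_mul_div_two_neg hα1 hα2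
  have hΓ : 0 < Real.Gamma (2 - α) := Real.Gamma_pos_of_pos (by linarith)
  have hα0 : 0 < α := by linarith
  set a : ℝ := (1 - α) / (Real.Gamma (2 - α) * Real.cos (Real.pi * α / 2)) with ha
  have ha0 : 0 < a := div_pos_of_neg_of_neg (by linarith) (mul_neg_of_pos_of_neg hΓ hcos)
  have hs : 0 < σ ^ α := Real.rpow_pos_of_pos hσ α
  -- The weights of the Lévy measure are `α` times the tail constants on the two sides. Their sum
  -- yields the scale and their difference the skewness of the law.
  obtain ⟨cp, hcp⟩ : ∃ cp : ℝ≥0, (cp : ℝ) = α * a * ((1 + β) / 2) * σ ^ α :=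
    ⟨⟨_, mul_nonneg (mul_nonneg (by positivity) (by linarith)) hs.le⟩, rfl⟩
  obtain ⟨cm, hcm⟩ : ∃ cm : ℝ≥0, (cm : ℝ) = α * a * ((1 - β) / 2) * σ ^ α :=
    ⟨⟨_, mul_nonneg (mul_nonneg (by positivity) (by linarith)) hs.le⟩, rfl⟩
  have hcp0 : 0 < cp := by
    rw [← NNReal.coe_pos, hcp]
    have : 0 < (1 + β) / 2 := by linarith
    positivity
  set ψ : ℝ → ℂ := fun θ => ((σ ^ α * |θ| ^ α : ℝ) : ℂ) *
    (1 - Complex.I * ((β * Real.sign θ * Real.tan (Real.pi * α / 2) : ℝ) : ℂ)) with hψ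
  have hchar : ∀ θ, charFun Q θ = Complex.exp (-ψ θ) := fun θ => by
    rw [hQ θ, stableCharFun, if_neg hα1.ne']
    simp [hψ]
  have hhom : ∀ y θ : ℝ, 0 < y → ψ (y⁻¹ * θ) = (y ^ (-α) : ℝ) * ψ θ := fun y θ hy => by
    have e1 : Real.sign (y⁻¹ * θ) = Real.sign θ := by
      have hy' : 0 < y⁻¹ := inv_pos.2 hy
      rcases lt_trichotomy θ 0 with h | rfl | h
      · rw [Real.sign_of_neg h, Real.sign_of_neg (mul_neg_of_pos_of_neg hy' h)]
      · simp
      · rw [Real.sign_of_pos h, Real.sign_of_pos (mul_pos hy' h)]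
    have e2 : |y⁻¹ * θ| ^ α = y ^ (-α) * |θ| ^ α := by
      rw [abs_mul, abs_of_pos (inv_pos.2 hy), Real.mul_rpow (inv_pos.2 hy).le (abs_nonneg _),
        Real.inv_rpow hy.le, ← Real.rpow_neg hy.le]
    simp only [hψ, e1, e2]
    push_cast
    ring
  set κ : ℝ := Real.Gamma (2 - α) / (α * (α - 1)) with hκ
  have hκa : κ * (α * a) * Real.cos (Real.pi * α / 2) = -1 := by
    have h1 : α - 1 ≠ 0 := by linarith
    have h2 := hΓ.ne
    have h3 := hcos.ne
    rw [hκ, ha]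
    generalize Real.cos (Real.pi * α / 2) = C at h3
    field_simp
    ring
  clear_value κ a
  have hκs : κ * (α * a) * Real.sin (Real.pi * α / 2) = -Real.tan (Real.pi * α / 2) := by
    have h3 := hcos.ne
    rw [Real.tan_eq_sin_div_cos, ← neg_div, eq_div_iff h3]
    linear_combination Real.sin (Real.pi * α / 2) * hκa
  -- The cosine parts add with weight `cp + cm` and give `-1`; the sine parts are odd in `θ`, so
  -- they carry `cp - cm` and give the term in `β tan(πα/2)`.
  have hkey : ∀ θ : ℝ, (cp : ℂ) * (κ * (-(θ * Complex.I)) ^ (α : ℂ)) +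
      cm * (κ * (-((-θ : ℝ) * Complex.I)) ^ (α : ℂ)) = -ψ θ := fun θ => by
    have hcp' : (cp : ℂ) = ((α * a * ((1 + β) / 2) * σ ^ α : ℝ) : ℂ) := by rw [← hcp]
    have hcm' : (cm : ℂ) = ((α * a * ((1 - β) / 2) * σ ^ α : ℝ) : ℂ) := by rw [← hcm]
    have hκa' : (κ : ℂ) * (α * a) * (Real.cos (Real.pi * α / 2) : ℝ) = -1 := by
      exact_mod_cast congrArg (Complex.ofReal) hκa
    have hκs' : (κ : ℂ) * (α * a) * (Real.sin (Real.pi * α / 2) : ℝ) =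
        -(Real.tan (Real.pi * α / 2) : ℝ) := by
      exact_mod_cast congrArg (Complex.ofReal) hκs
    have hsign : Real.sign (-θ) = -Real.sign θ := by
      rw [Real.sign_neg]
    rw [neg_mul_I_cpow hα0.ne', neg_mul_I_cpow hα0.ne', hcp', hcm', abs_neg, hsign]
    simp only [hψ]
    generalize Real.cos (Real.pi * α / 2) = C at *
    generalize Real.sin (Real.pi * α / 2) = D at *
    generalize Real.tan (Real.pi * α / 2) = t at *
    generalize |θ| ^ α = w at *
    generalize σ ^ α = s at *
    push_cast
    linear_combination (s * w : ℂ) * hκa' - (s * w * β * Real.sign θ * Complex.I : ℂ) * hκs'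
  have hν : ∀ θ, charFun (tiltedLevyMeasure α cp cm) θ =
      -ψ θ + (1 / 2) * ψ (θ + 1) + (1 / 2) * ψ (θ - 1) := fun θ => by
    have h0 := hkey θ
    have h1 := hkey (θ + 1)
    have h2 := hkey (θ - 1)
    -- Reflection exchanges the two shifts in the second difference.
    have e1 : -(θ + 1) = -θ - 1 := by ring
    have e2 : -(θ - 1) = -θ + 1 := by ring
    rw [e1] at h1
    rw [e2] at h2
    rw [charFun_tiltedLevyMeasure hα1 hα2, charFun_tiltedHalfMeasure hα1 hα2,
      charFun_tiltedHalfMeasure hα1 hα2, ← hκ]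
    linear_combination h0 - (1 / 2) * h1 - (1 / 2) * h2
  have hann := tendsto_rpow_mul_measureReal_Ioc hα1 hα2 hcp0 hchar hhom hν
  have h2α : (1 : ℝ) - 2 ^ (-α) ≠ 0 := by
    have : (2 : ℝ) ^ (-α) < 1 := Real.rpow_lt_one_of_one_lt_of_neg one_lt_two (by linarith)
    linarith
  have := tendsto_rpow_mul_of_dyadic hα0 (G := fun y => Q.real (Set.Ioi y))
    (fun x y h => measureReal_mono (Set.Ioi_subset_Ioi h)) (tendsto_measureReal_Ioi_atTop Q)
    (K := cp / α * (1 - 2 ^ (-α))) (hann.congr' (by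
      filter_upwards [eventually_gt_atTop 0] with y hy
      have hy2 : y ≤ 2 * y := by linarith
      rw [← Set.Ioc_union_Ioi_eq_Ioi hy2, measureReal_union
        (Set.Ioc_disjoint_Ioi le_rfl) measurableSet_Ioi,
        add_sub_cancel_right]))
  rw [mul_div_assoc, div_self h2α, mul_one, hcp] at this
  convert this using 2
  field_simp

end Tails

/-! ### The two asymptotics -/

theorem proposition1p1 {Ω : Type*} [MeasurableSpace Ω] (P : Measure Ω) [IsProbabilityMeasure P]
    (X : ℝ≥0 → Ω → ℝ) (c : ℝ) (hc : 0 < c) (S : ℝ≥0) (hS : 0 < S)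
    (T : ℝ≥0 → ℝ≥0) (hT_meas : Measurable T) (hT_pos : ∀ u, 0 < T u)
    (hT_bdd : ∃ M : ℝ≥0, ∀ u, T u ≤ M) :
    (IsLevyProcess P X → IsLongTailed (P.map (X S)) →
      (fun u : ℝ≥0 => parisianRuinProb P X c S u (T u)) ~[atTop]
        (fun u : ℝ≥0 => P.real {ω | (u : ℝ) < X S ω})) ∧
    (∀ α β : ℝ, 1 < α → α < 2 → -1 < β → β ≤ 1 → IsStableLevyProcess P X α β →
      (fun u : ℝ≥0 => parisianRuinProb P X c S u (T u)) ~[atTop]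
        (fun u : ℝ≥0 => (1 - α) / (Real.Gamma (2 - α) * Real.cos (Real.pi * α / 2)) *
          ((1 + β) / 2) * (S : ℝ) * (u : ℝ) ^ (-α))) := by
  refine ⟨fun hX hlong => hX.parisianRuinProb_isEquivalent hc hS hT_pos hT_bdd hlong,
    fun α β hα1 hα2 hβ1 hβ2 ⟨hX, hstable⟩ => ?_⟩
  have hS' : (0 : ℝ) < S := hS
  have := Measure.isProbabilityMeasure_map (μ := P) (hX.measurable S).aemeasurable
  have htail := (hstable S hS).tendsto_rpow_mul_measureReal_Ioi hα1 hα2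
    (Real.rpow_pos_of_pos hS' _) hβ1 hβ2
  rw [← Real.rpow_mul hS'.le, one_div_mul_cancel (by linarith : α ≠ 0), Real.rpow_one] at htail
  set K : ℝ := (1 - α) / (Real.Gamma (2 - α) * Real.cos (Real.pi * α / 2)) * ((1 + β) / 2) * S
    with hK
  have hK0 : 0 < K := by
    have h1 : 0 < (1 - α) / (Real.Gamma (2 - α) * Real.cos (Real.pi * α / 2)) :=
      div_pos_of_neg_of_neg (by linarith) (mul_neg_of_pos_of_neg
        (Real.Gamma_pos_of_pos (by linarith)) (cos_pi_mul_div_two_neg hα1 hα2))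
    have h2 : 0 < (1 + β) / 2 := by linarith
    positivity
  refine (hX.parisianRuinProb_isEquivalent hc hS hT_pos hT_bdd
    (isLongTailed_of_tendsto_rpow_mul hK0 htail)).trans ?_
  have hpos : ∀ᶠ u : ℝ≥0 in atTop, 0 < u := eventually_gt_atTop 0
  have hne : ∀ᶠ u : ℝ≥0 in atTop, K * (u : ℝ) ^ (-α) ≠ 0 := hpos.mono fun u hu =>
    (mul_pos hK0 (Real.rpow_pos_of_pos (show (0 : ℝ) < u from hu) _)).ne'
  rw [isEquivalent_iff_tendsto_one hne]
  have hlim := (htail.comp (NNReal.tendsto_coe_atTop.2 tendsto_id)).div_const K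
  rw [div_self hK0.ne'] at hlim
  refine hlim.congr' ?_
  filter_upwards [hpos] with u hu
  have hmap : (P.map (X S)).real (Set.Ioi (u : ℝ)) = P.real {ω | (u : ℝ) < X S ω} := by
    rw [map_measureReal_apply (hX.measurable S) measurableSet_Ioi]
    rfl
  have hu' := (Real.rpow_pos_of_pos (show (0 : ℝ) < u from hu) α).ne'
  simp only [Function.comp_def, Pi.div_apply, id]
  rw [hmap, Real.rpow_neg (NNReal.coe_nonneg u)]
  field_simp
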